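/- \textbf{Setting.} Fix a separation constant $\hbar\ge 1$ and a horizon $T\ge 0$. Consider networks with input $z^0=x$ and layers $z^{l}=\phi\big(\tfrac{1}{\sqrt{n_l}}W^{l}z^{l-1}\big)$ for $1\le l\le K\hbar$, where $W^l\in\mathbb{R}^{n_l\times n_{l-1}}$ and $\phi$ acts entrywise. The output dimension and the widths of the layers with shortcuts are equal, $n=n_o=n_0=n_\hbar=n_{2\hbar}=\dots=n_{K\hbar}$; all widths are positive and satisfy $n_l\le C_w n$ with a constant $C_w$. The output is $$f(x)=\frac{1}{\sqrt{M_z}}\sum_{\kappa=0}^{K}z^{\kappa\hbar}(x)\in\mathbb{R}^n,\qquad M_z=\sum_{\kappa=0}^K n_{\kappa\hbar}.$$ For inputs $x,x'$ the depth-induced NTK is the $n\times n$ matrix $$\mathrm{NTK}_{(d)}(x,x')=\sum_{\kappa'=1}^{K}\Big(\mathrm{D}_b\{{W^{\kappa'\hbar}}^{\top}\}\tfrac{\partial f(x)}{\partial W^{\kappa'\hbar}}\Big)^{\!\top}\Big(\mathrm{D}_b\{{W^{\kappa'\hbar}}^{\top}\}\tfrac{\partial f(x')}{\partial W^{\kappa'\hbar}}\Big),$$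 where $\partial f/\partial W^{l}$ is the $n_ln_{l-1}\times n$ matrix of partial derivatives of the outputs in the entries of $W^l$, stacked column by column of $W^l$, and $\mathrm{D}_b\{{W^l}^\top\}$ is the block diagonal matrix with $n_{l-1}$ blocks ${W^l}^\top$. Its trace is the scalar kernel obtained by using the Frobenius inner product in place of the product of matrices. Let $\mathcal D$ (depending on the network size) be a probability distribution on the input space $\mathbb{R}^{n}$ with $\mathbb{E}_{x\sim\mathcal D}\|x\|^2\le C_{\mathcal D}\,n$ for a constant $C_{\mathcal D}$, and put $\langle g,h\rangle_{\mathcal D}=\mathbb{E}_{x\sim\mathcal D}[g(x)^\top h(x)]$, $\|g\|_{\mathcal D}^2=\langle g,g\rangle_{\mathcal D}$. The (random) weights are differentiable functions of $t\in[0,T]$ and almost surely follow $$\frac{\partial W^l}{\partial t}=\Big\langle\frac{\partial f}{\partial W^l},d_t\Big\rangle_{\mathcal D},\qquad 1\le l\le K\hbar,$$ for a (random) training direction $d_t:\mathbb{R}^{n}\to\mathbb{R}^{n}$, square integrable with respect to $\mathcal D$. \textbf{Theorem 4} (Training Invariance of Depth-induced NTK). Assume that (1) $\phi:\mathbb{R}\to\mathbb{R}$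 is well-posed, i.e. differentiable with $|\dot\phi|\le C_\phi$ for a constant $C_\phi$, its derivative $\dot\phi$ is continuous, and $\phi$ is Lipschitz; (2) the initial weight matrices are stable-pertinent for $\phi$: almost surely $C_\phi\|W^l(0)\|_s\le\epsilon$ for all $1\le l\le K\hbar$, where $\|\cdot\|_s$ is the spectral norm and $0<\epsilon<1$ is a constant; (3) $\int_0^T\|d_t\|_{\mathcal D}\,dt$ is stochastically bounded (bounded in probability) along the limit below. Let $\lambda\in(0,1)$ and let $K\to\infty$ and $n\to\infty$ with $n=\Omega(K^{2/\lambda})$. Then $\mathrm{NTK}_{(d)}(t)\to\mathrm{NTK}_{(d)}(0)$ in probability, uniformly for $t\in[0,T]$: for every $B$, both $$\sup\big\|\mathrm{NTK}_{(d)}(t)(x,x')-\mathrm{NTK}_{(d)}(0)(x,x')\big\|_F\quad\text{and}\quad\sup\big|\operatorname{tr}\mathrm{NTK}_{(d)}(t)(x,x')-\operatorname{tr}\mathrm{NTK}_{(d)}(0)(x,x')\big|$$ tend to $0$ in probability, where the suprema are over $t\in[0,T]$ and all inputs $x,x'\in\mathbb{R}^n$ with $\|x\|,\|x'\|\le B\sqrt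 n$. -/

import Mathlib

open MeasureTheory Filter Topology Set
open scoped ENNReal NNReal Matrix

noncomputable section

namespace DepthNTK

/-- The activation `φ` is differentiable and its derivative is bounded by the constant `C`. -/
structure WellPosed (φ : ℝ → ℝ) (C : ℝ) : Prop where
  differentiable : Differentiable ℝ φ
  bound : ∀ x, |deriv φ x| ≤ C

section
open scoped Matrix.Norms.L2Operator

/-- The spectral norm (largest singular value) of a real matrix. -/
def specNorm {p q : ℕ} (A : Matrix (Fin p) (Fin q) ℝ) : ℝ := ‖A‖

end

/-- The Frobenius norm of a real matrix. -/
def frobNorm {p q : ℕ} (A : Matrix (Fin p) (Fin q) ℝ) : ℝ := √(∑ i, ∑ j, A i j ^ 2)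

/-- A weight matrix `A` is stable-pertinent (with derivative bound `C` and constant `ε`). -/
def StablePertinent (C ε : ℝ) {p q : ℕ} (A : Matrix (Fin p) (Fin q) ℝ) : Prop :=
  C * specNorm A ≤ ε

/-- The weights of a network whose layer `l` has `w l` neurons (layer `0` is the input).
`W l` is the weight matrix from layer `l` to layer `l + 1`, that is, the matrix of layer `l + 1`. -/
abbrev Weights (w : ℕ → ℕ) : Type :=
  (l : ℕ) → Matrix (Fin (w (l + 1))) (Fin (w l)) ℝ

/-- Forward propagation: `z⁰ = x` and `zˡ⁺¹ = φ (Wˡ⁺¹ zˡ / √nₗ₊₁)`, with `φ` acting entrywise. -/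
def layer (φ : ℝ → ℝ) {w : ℕ → ℕ} (W : Weights w) (x : EuclideanSpace ℝ (Fin (w 0))) :
    (l : ℕ) → Fin (w l) → ℝ
  | 0 => fun j => x j
  | l + 1 => fun p => φ (1 / √(w (l + 1) : ℝ) * (W l *ᵥ layer φ W x l) p)

/-- The unit shortcut connection: the identity matrix when the two dimensions agree. -/
def shortcut (no m : ℕ) : Matrix (Fin no) (Fin m) ℝ :=
  Matrix.of fun o j => if (o : ℕ) = (j : ℕ) then 1 else 0

/-- The scaling constant of the output, the total width of the layers `0, h, 2h, …, K h`. -/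
def totalWidth (w : ℕ → ℕ) (h K : ℕ) : ℕ := ∑ k ∈ Finset.range (K + 1), w (k * h)

/-- The output of the shortcut-related network with separation constant `h` and `K` shortcuts:
the normalised sum of the layers `0, h, 2h, …, K h`. -/
def net (φ : ℝ → ℝ) {w : ℕ → ℕ} (h K no : ℕ) (W : Weights w)
    (x : EuclideanSpace ℝ (Fin (w 0))) : EuclideanSpace ℝ (Fin no) :=
  WithLp.toLp 2 ((1 / √(totalWidth w h K : ℝ)) •
    ∑ k ∈ Finset.range (K + 1), shortcut no (w (k * h)) *ᵥ layer φ W x (k * h))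

/-- The partial derivative of the output (at the input `x`) in the weight `(W l) p j`. -/
def partialW (φ : ℝ → ℝ) {w : ℕ → ℕ} (h K no : ℕ) (W : Weights w) (l : ℕ)
    (p : Fin (w (l + 1))) (j : Fin (w l)) (x : EuclideanSpace ℝ (Fin (w 0))) :
    EuclideanSpace ℝ (Fin no) :=
  deriv (fun s : ℝ => net φ h K no (Function.update W l (W l + Matrix.single p j s)) x) 0

/-- The gradient of the output in the matrix `W l`, as a matrix with one row for each entry of
`W l` and one column for each output coordinate. -/
def gradW (φ : ℝ → ℝ) {w : ℕ → ℕ} (h K no : ℕ) (W : Weights w) (l : ℕ)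
    (x : EuclideanSpace ℝ (Fin (w 0))) : Matrix (Fin (w (l + 1)) × Fin (w l)) (Fin no) ℝ :=
  Matrix.of fun pj o => partialW φ h K no W l pj.1 pj.2 x o

/-- The gradient in `W l`, multiplied by the block diagonal matrix with `w l` blocks `(W l)ᵀ`,
one for each column of `W l`. -/
def scaledGradW (φ : ℝ → ℝ) {w : ℕ → ℕ} (h K no : ℕ) (W : Weights w) (l : ℕ)
    (x : EuclideanSpace ℝ (Fin (w 0))) : Matrix (Fin (w l) × Fin (w l)) (Fin no) ℝ :=
  Matrix.blockDiagonal (fun _ : Fin (w l) => (W l)ᵀ) * gradW φ h K no W l x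

/-- The depth-induced neural tangent kernel, a matrix indexed by pairs of output coordinates:
the sum over the layers `k h`, `1 ≤ k ≤ K`, of the inner products of the scaled gradients
(the matrix of layer `k h` is `W (k h - 1)`). -/
def ntk (φ : ℝ → ℝ) {w : ℕ → ℕ} (h K no : ℕ) (W : Weights w)
    (x x' : EuclideanSpace ℝ (Fin (w 0))) : Matrix (Fin no) (Fin no) ℝ :=
  ∑ k ∈ Finset.Icc 1 K,
    (scaledGradW φ h K no W (k * h - 1) x)ᵀ * scaledGradW φ h K no W (k * h - 1) x'

/-- The bilinear form `⟨g, g'⟩_D = E_{x ∼ D} [g(x)ᵀ g'(x)]` on functions of the input. -/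
def innerD {m no : ℕ} (D : Measure (EuclideanSpace ℝ (Fin m)))
    (g g' : EuclideanSpace ℝ (Fin m) → EuclideanSpace ℝ (Fin no)) : ℝ :=
  ∫ x, inner ℝ (g x) (g' x) ∂D

/-- The path of weights `W` follows `∂Wˡ/∂t = ⟨∂f/∂Wˡ, d_t⟩_D` on `[0, T]` in every layer,
with a training direction `d_t` that is square integrable for `D`. -/
structure IsGradientFlow (φ : ℝ → ℝ) {w : ℕ → ℕ} (h K no : ℕ)
    (D : Measure (EuclideanSpace ℝ (Fin (w 0)))) (T : ℝ)
    (d : ℝ → EuclideanSpace ℝ (Fin (w 0)) → EuclideanSpace ℝ (Fin no))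
    (W : ℝ → Weights w) : Prop where
  memLp : ∀ t ∈ Icc 0 T, MemLp (d t) 2 D
  flow : ∀ t ∈ Icc 0 T, ∀ l < K * h, ∀ (p : Fin (w (l + 1))) (j : Fin (w l)),
    HasDerivWithinAt (fun s => W s l p j)
      (innerD D (partialW φ h K no (W t) l p j) (d t)) (Icc 0 T) t

/-- `∫₀ᵀ ‖d_t‖_D dt`, where `‖g‖_D ^ 2 = ⟨g, g⟩_D`. -/
def totalDirection {m no : ℕ} (D : Measure (EuclideanSpace ℝ (Fin m))) (T : ℝ)
    (d : ℝ → EuclideanSpace ℝ (Fin m) → EuclideanSpace ℝ (Fin no)) : ℝ≥0∞ :=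
  ∫⁻ t in Icc 0 T, eLpNorm (d t) 2 D

/-- A sequence of nonnegative random quantities is stochastically bounded (bounded in
probability). -/
def StochBounded {Ω : ℕ → Type*} [∀ i, MeasurableSpace (Ω i)] (P : ∀ i, Measure (Ω i))
    (X : ∀ i, Ω i → ℝ≥0∞) : Prop :=
  ∀ η : ℝ, 0 < η → ∃ M : ℝ, ∀ᶠ i in atTop,
    P i {ω | ENNReal.ofReal M < X i ω} ≤ ENNReal.ofReal η

end DepthNTK

end

noncomputable section

namespace DepthNTK

/-! Stable pertinence makes each layer a contraction: while `C * ‖W l‖ ≤ e < 1`, layer vectors stay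
within `‖x‖ + A`, and a perturbation injected at one layer has total response over all later layers
bounded by a geometric series, independently of depth (`l2_layer_le`,
`sum_l2_pushTangent_single_le`).

The output carries the factor `1 / √M` with `M = (K + 1) n`, while inputs and layers have size of
order `√n`. A weight gradient is therefore of order `1 / √(K + 1)`, so every weight matrix moves by
at most `ρ = O(1 / √(K + 1))` in Frobenius norm. This uses stability along the path, and stability
follows from the small displacement; a first-exit-time argument closes the circle
(`IsGradientFlow.stable_and_frobNorm_sub_le`).

The partial derivative in one weight is a layer entry times the response to a basis vector, so the
kernel is a sum over shortcut layers of a scalar `⟨z, z'⟩` times `Rᵀ R'` (`ntk_eq`), where `R`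
collects the responses to the columns of the weight matrix. There are two different reasons for
convergence. In Frobenius norm each kernel is itself `O(1 / √n)`, since `R` has operator norm
smaller than its Frobenius bound by a factor `√n` (`frobNorm_ntk_le`). The trace need not vanish, so
it requires a perturbation estimate (`abs_trace_ntk_sub_le`). Up to `O(1 / √n)`, the rescaled `R` is
the direct contribution of its own layer (`l2_outMap_sub_directMap_le`), involving only `W` and
`deriv φ` at preactivations. At shortcut layers these lie in a fixed compact interval and move by
`O(ρ)`, so uniform continuity of `deriv φ` finishes the proof. -/

/-- The Euclidean norm of a finite family of real numbers. -/
def l2 {ι : Type*} [Fintype ι] (v : ι → ℝ) : ℝ := ‖(WithLp.toLp 2 v : EuclideanSpace ℝ ι)‖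

/-! ### Euclidean norms of finite families. -/

section l2

variable {ι κ : Type*} [Fintype ι] [Fintype κ]

theorem l2_nonneg (v : ι → ℝ) : 0 ≤ l2 v := norm_nonneg _

theorem l2_sq (v : ι → ℝ) : l2 v ^ 2 = ∑ i, v i ^ 2 := by
  simp [l2, EuclideanSpace.norm_sq_eq]

theorem l2_eq_sqrt (v : ι → ℝ) : l2 v = √(∑ i, v i ^ 2) := by
  rw [← l2_sq, Real.sqrt_sq (l2_nonneg v)]

theorem l2_zero : l2 (0 : ι → ℝ) = 0 := by simp [l2]

theorem l2_add_le (v u : ι → ℝ) : l2 (v + u) ≤ l2 v + l2 u := norm_add_le _ _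

theorem l2_sub_le (v u : ι → ℝ) : l2 (v - u) ≤ l2 v + l2 u := norm_sub_le _ _

theorem l2_smul (c : ℝ) (v : ι → ℝ) : l2 (c • v) = |c| * l2 v := by
  simp [l2, WithLp.toLp_smul, norm_smul]

theorem l2_sum_le {α : Type*} (s : Finset α) (f : α → ι → ℝ) :
    l2 (∑ a ∈ s, f a) ≤ ∑ a ∈ s, l2 (f a) := by
  simp only [l2, WithLp.toLp_sum]
  exact norm_sum_le _ _

theorem l2_le_of_abs_le {v u : ι → ℝ} (huv : ∀ i, |v i| ≤ |u i|) : l2 v ≤ l2 u := by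
  rw [l2_eq_sqrt, l2_eq_sqrt]
  exact Real.sqrt_le_sqrt (Finset.sum_le_sum fun i _ => sq_le_sq.2 (huv i))

theorem l2_le_mul_of_abs_le {c : ℝ} (hc : 0 ≤ c) {v u : ι → ℝ} (huv : ∀ i, |v i| ≤ c * |u i|) :
    l2 v ≤ c * l2 u := by
  rw [← abs_of_nonneg hc, ← l2_smul]
  refine l2_le_of_abs_le fun i => ?_
  simpa [abs_mul, abs_of_nonneg hc] using huv i

theorem abs_le_l2 (v : ι → ℝ) (i : ι) : |v i| ≤ l2 v := by
  simpa [l2] using PiLp.norm_apply_le (WithLp.toLp 2 v : EuclideanSpace ℝ ι) i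

theorem abs_dotProduct_le (v u : ι → ℝ) : |∑ i, v i * u i| ≤ l2 v * l2 u := by
  have := abs_real_inner_le_norm (WithLp.toLp 2 u : EuclideanSpace ℝ ι) (WithLp.toLp 2 v)
  simpa [l2, PiLp.inner_apply, mul_comm] using this

theorem l2_const (c : ℝ) : l2 (fun _ : ι => c) = √(Fintype.card ι : ℝ) * |c| := by
  simp [l2_eq_sqrt, Real.sqrt_sq_eq_abs]

end l2

/-! ### Frobenius norms, operator bounds and the shortcut matrix. -/

section matrix

variable {p q r : ℕ}

theorem frobNorm_eq_l2 (A : Matrix (Fin p) (Fin q) ℝ) :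
    frobNorm A = l2 (fun ij : Fin p × Fin q => A ij.1 ij.2) := by
  rw [l2_eq_sqrt, frobNorm, Fintype.sum_prod_type]

theorem frobNorm_nonneg (A : Matrix (Fin p) (Fin q) ℝ) : 0 ≤ frobNorm A := Real.sqrt_nonneg _

theorem frobNorm_sq (A : Matrix (Fin p) (Fin q) ℝ) : frobNorm A ^ 2 = ∑ i, ∑ j, A i j ^ 2 :=
  Real.sq_sqrt (Finset.sum_nonneg fun _ _ => Finset.sum_nonneg fun _ _ => sq_nonneg _)

theorem frobNorm_sub_le (A B : Matrix (Fin p) (Fin q) ℝ) :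
    frobNorm (A - B) ≤ frobNorm A + frobNorm B := by
  simp only [frobNorm_eq_l2]
  exact l2_sub_le _ _

theorem frobNorm_sum_le {α : Type*} (s : Finset α) (f : α → Matrix (Fin p) (Fin q) ℝ) :
    frobNorm (∑ a ∈ s, f a) ≤ ∑ a ∈ s, frobNorm (f a) := by
  simp only [frobNorm_eq_l2]
  convert l2_sum_le s (fun a (ij : Fin p × Fin q) => f a ij.1 ij.2) using 2
  ext ij
  simp [Matrix.sum_apply]

theorem l2_mulVec_le_frobNorm (A : Matrix (Fin p) (Fin q) ℝ) (v : Fin q → ℝ) :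
    l2 (A *ᵥ v) ≤ frobNorm A * l2 v := by
  refine (pow_le_pow_iff_left₀ (l2_nonneg _)
    (mul_nonneg (frobNorm_nonneg _) (l2_nonneg _)) two_ne_zero).1 ?_
  rw [mul_pow, l2_sq, frobNorm_sq, Finset.sum_mul]
  refine Finset.sum_le_sum fun i _ => ?_
  rw [l2_sq]
  exact Finset.sum_mul_sq_le_sq_mul_sq Finset.univ (A i) v

theorem l2_mulVec_le_specNorm (A : Matrix (Fin p) (Fin q) ℝ) (v : Fin q → ℝ) :
    l2 (A *ᵥ v) ≤ specNorm A * l2 v :=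
  Matrix.l2_opNorm_mulVec A (WithLp.toLp 2 v)

/-- Testing the matrix on its own row `i` gives `l2 (A i) ^ 2` as coordinate `i` of the image. -/
theorem l2_row_le {A : Matrix (Fin p) (Fin q) ℝ} {C c : ℝ} (hC : 0 ≤ C)
    (hA : ∀ v, C * l2 (A *ᵥ v) ≤ c * l2 v) (hc : 0 ≤ c) (i : Fin p) : C * l2 (A i) ≤ c := by
  have h1 : l2 (A i) ^ 2 ≤ l2 (A *ᵥ A i) := by
    refine le_trans (le_of_eq ?_) (le_trans (le_abs_self _) (abs_le_l2 (A *ᵥ A i) i))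
    rw [l2_sq]
    simp [Matrix.mulVec, dotProduct, sq]
  have h2 := hA (A i)
  rcases (l2_nonneg (A i)).eq_or_lt with h0 | h0
  · rw [← h0]; simpa using hc
  · nlinarith [mul_le_mul_of_nonneg_left h1 hC]

/-- Only the number of rows enters: for the matrix of a shortcut layer this is `n`, whatever the
width of the layer before it. -/
theorem frobNorm_le_of_mulVec_le {A : Matrix (Fin p) (Fin q) ℝ} {C c : ℝ} (hC : 0 ≤ C)
    (hA : ∀ v, C * l2 (A *ᵥ v) ≤ c * l2 v) (hc : 0 ≤ c) : C * frobNorm A ≤ √(p : ℝ) * c := by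
  refine (pow_le_pow_iff_left₀ (mul_nonneg hC (frobNorm_nonneg _))
    (by positivity) two_ne_zero).1 ?_
  rw [mul_pow, mul_pow, frobNorm_sq, Real.sq_sqrt (by positivity), Finset.mul_sum]
  calc ∑ i, C ^ 2 * ∑ j, A i j ^ 2 ≤ ∑ _i : Fin p, c ^ 2 := by
        refine Finset.sum_le_sum fun i _ => ?_
        rw [← l2_sq (A i), ← mul_pow]
        exact pow_le_pow_left₀ (mul_nonneg hC (l2_nonneg _)) (l2_row_le hC hA hc i) 2
    _ = p * c ^ 2 := by simp

/-- The shortcut is a 0-1 matrix with at most one 1 in each row and column; Cauchy-Schwarz on rows,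
then summing columns, gives the contraction. -/
theorem l2_shortcut_mulVec_le (v : Fin q → ℝ) : l2 (shortcut p q *ᵥ v) ≤ l2 v := by
  have row : ∀ o, ∑ j, shortcut p q o j ≤ 1 := by
    intro o
    simp only [shortcut, Matrix.of_apply, Finset.sum_boole]
    exact_mod_cast Finset.card_le_one.2 fun a ha b hb => by
      simp only [Finset.mem_filter, Finset.mem_univ, true_and] at ha hb
      exact Fin.ext (ha.symm.trans hb)
  have col : ∀ j, ∑ o, shortcut p q o j ≤ 1 := by
    intro j
    simp only [shortcut, Matrix.of_apply, Finset.sum_boole]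
    exact_mod_cast Finset.card_le_one.2 fun a ha b hb => by
      simp only [Finset.mem_filter, Finset.mem_univ, true_and] at ha hb
      exact Fin.ext (ha.trans hb.symm)
  have idem : ∀ o j, shortcut p q o j ^ 2 = shortcut p q o j := by
    intro o j
    simp only [shortcut, Matrix.of_apply]
    split_ifs <;> norm_num
  have nonneg : ∀ o j, 0 ≤ shortcut p q o j := fun o j => idem o j ▸ sq_nonneg _
  rw [l2_eq_sqrt, l2_eq_sqrt]
  refine Real.sqrt_le_sqrt ?_
  calc ∑ o, (shortcut p q *ᵥ v) o ^ 2 ≤ ∑ o, ∑ j, shortcut p q o j * v j ^ 2 := by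
        refine Finset.sum_le_sum fun o _ => ?_
        have h1 : (shortcut p q *ᵥ v) o = ∑ j, shortcut p q o j * (shortcut p q o j * v j) := by
          refine (Finset.sum_congr rfl fun j _ => ?_ : ∑ j, shortcut p q o j * v j = _)
          rw [← mul_assoc, ← sq, idem]
        rw [h1]
        refine (Finset.sum_mul_sq_le_sq_mul_sq _ _ _).trans ?_
        simp only [mul_pow, idem]
        exact mul_le_of_le_one_left
          (Finset.sum_nonneg fun j _ => mul_nonneg (nonneg o j) (sq_nonneg _)) (row o)
    _ = ∑ j, (∑ o, shortcut p q o j) * v j ^ 2 := by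
        rw [Finset.sum_comm]
        simp only [Finset.sum_mul]
    _ ≤ ∑ j, v j ^ 2 :=
        Finset.sum_le_sum fun j _ => mul_le_of_le_one_left (sq_nonneg _) (col j)

end matrix

/-! ### Forward propagation and its stability under changes of the weights. -/

/-- The argument of the activation in layer `l + 1`. -/
def preact (φ : ℝ → ℝ) {w : ℕ → ℕ} (W : Weights w) (x : EuclideanSpace ℝ (Fin (w 0))) (l : ℕ) :
    Fin (w (l + 1)) → ℝ :=
  fun p => 1 / √(w (l + 1) : ℝ) * (W l *ᵥ layer φ W x l) p

/-- Forward propagation of tangent vectors along the layers, where `src l` is added to the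
tangent vector before it passes through the activation of layer `l + 1`. -/
def pushTangent (φ : ℝ → ℝ) {w : ℕ → ℕ} (W : Weights w) (x : EuclideanSpace ℝ (Fin (w 0)))
    (src : (l : ℕ) → Fin (w (l + 1)) → ℝ) : (l : ℕ) → Fin (w l) → ℝ
  | 0 => 0
  | l + 1 => fun p => deriv φ (preact φ W x l p) *
      (1 / √(w (l + 1) : ℝ) * ((W l *ᵥ pushTangent φ W x src l) p + src l p))

/-- The quantitative form of stable pertinence: `A ↦ C * ‖A‖` is at most `e` on the first `N`
weight matrices. -/
def Stable (C e : ℝ) {w : ℕ → ℕ} (W : Weights w) (N : ℕ) : Prop :=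
  ∀ l < N, ∀ v, C * l2 (W l *ᵥ v) ≤ e * l2 v

theorem WellPosed.nonneg {φ : ℝ → ℝ} {C : ℝ} (hφ : WellPosed φ C) : 0 ≤ C :=
  (abs_nonneg _).trans (hφ.bound 0)

theorem WellPosed.abs_sub_le {φ : ℝ → ℝ} {C : ℝ} (hφ : WellPosed φ C) (a b : ℝ) :
    |φ a - φ b| ≤ C * |a - b| := by
  simpa using convex_univ.norm_image_sub_le_of_norm_deriv_le (f := φ) (C := C)
    (fun x _ => hφ.differentiable x) (fun x _ => hφ.bound x) (mem_univ b) (mem_univ a)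

section estimates

variable {φ : ℝ → ℝ} {C e : ℝ} {w : ℕ → ℕ} {W W' : Weights w} {N : ℕ}

/-- The Frobenius norm dominates the operator norm, so training may use up the margin between the
initial stability constant and 1. -/
theorem Stable.of_frobNorm_sub_le {c : ℝ} (hC : 0 ≤ C) (hW' : Stable C e W' N)
    (hsub : ∀ l < N, C * frobNorm (W l - W' l) ≤ c) : Stable C (e + c) W N := by
  intro l hl v
  have h1 : W l *ᵥ v = W' l *ᵥ v + (W l - W' l) *ᵥ v := by
    rw [← Matrix.add_mulVec, add_sub_cancel]
  calc C * l2 (W l *ᵥ v) ≤ C * (l2 (W' l *ᵥ v) + frobNorm (W l - W' l) * l2 v) := by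
        rw [h1]
        gcongr
        exact (l2_add_le _ _).trans (by gcongr; exact l2_mulVec_le_frobNorm _ _)
    _ = C * l2 (W' l *ᵥ v) + C * frobNorm (W l - W' l) * l2 v := by ring
    _ ≤ e * l2 v + c * l2 v :=
        add_le_add (hW' l hl v) (mul_le_mul_of_nonneg_right (hsub l hl) (l2_nonneg _))
    _ = (e + c) * l2 v := by ring

theorem layer_succ (x : EuclideanSpace ℝ (Fin (w 0))) (l : ℕ) :
    layer φ W x (l + 1) = fun p => φ (preact φ W x l p) := rfl

theorem l2_preact (x : EuclideanSpace ℝ (Fin (w 0))) (l : ℕ) :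
    l2 (preact φ W x l) = 1 / √(w (l + 1) : ℝ) * l2 (W l *ᵥ layer φ W x l) := by
  rw [show preact φ W x l = (1 / √(w (l + 1) : ℝ)) • (W l *ᵥ layer φ W x l) from rfl, l2_smul,
    abs_of_nonneg (by positivity)]

theorem one_div_sqrt_le_one {m : ℕ} (hm : 0 < m) : 1 / √(m : ℝ) ≤ 1 := by
  rw [div_le_one (by positivity)]
  exact Real.one_le_sqrt.2 (by exact_mod_cast hm)

/-- One layer sends a bound `s` to `e * s + |φ 0| * b`; the condition on `A` makes `‖x‖ + A`
invariant under this map. -/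
theorem l2_layer_le (hφ : WellPosed φ C) (he : 0 ≤ e) (he1 : e ≤ 1) (hW : Stable C e W N)
    (hw0 : ∀ l ≤ N, 0 < w l) {b A : ℝ} (hb : ∀ l ≤ N, √(w l : ℝ) ≤ b)
    (hA : |φ 0| * b ≤ (1 - e) * A) (hA0 : 0 ≤ A) (x : EuclideanSpace ℝ (Fin (w 0))) :
    ∀ l ≤ N, l2 (layer φ W x l) ≤ ‖x‖ + A := by
  intro l
  induction l with
  | zero => exact fun _ => (le_of_eq rfl : l2 (layer φ W x 0) ≤ ‖x‖).trans (by linarith)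
  | succ l ih =>
    intro hl
    have ih := ih (by omega)
    have h1 : layer φ W x (l + 1) =
        (fun p => φ (preact φ W x l p) - φ 0) + fun _ => φ 0 := by
      ext p; simp [layer_succ]
    have h2 : l2 (fun p => φ (preact φ W x l p) - φ 0) ≤ C * l2 (preact φ W x l) :=
      l2_le_mul_of_abs_le hφ.nonneg fun p => by simpa using hφ.abs_sub_le (preact φ W x l p) 0
    have h3 : C * l2 (preact φ W x l) ≤ e * l2 (layer φ W x l) := by
      rw [l2_preact, mul_left_comm]
      have := hW l (by omega) (layer φ W x l)
      exact (mul_le_of_le_one_left (mul_nonneg hφ.nonneg (l2_nonneg _))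
        (one_div_sqrt_le_one (hw0 _ hl))).trans this
    have h4 : l2 (fun _ : Fin (w (l + 1)) => φ 0) ≤ |φ 0| * b := by
      rw [l2_const, mul_comm, Fintype.card_fin]
      gcongr
      exact hb _ hl
    rw [h1]
    nlinarith [l2_add_le (fun p => φ (preact φ W x l p) - φ 0) (fun _ => φ 0),
      mul_le_mul_of_nonneg_left ih he, mul_le_of_le_one_left (norm_nonneg x) he1, h4]

/-- Splits `W z - W' z'` as `W (z - z') + (W - W') z'`. The factor `√(w (l + 1))` is kept because at
a shortcut layer it cancels the `√n` in `Z`. -/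
theorem sqrt_mul_l2_preact_sub_le (hC : 0 ≤ C) (hW : Stable C e W N)
    (hw0 : ∀ l ≤ N, 0 < w l) {ρ Z : ℝ} (hρ0 : 0 ≤ ρ) (hρ : ∀ l < N, frobNorm (W l - W' l) ≤ ρ)
    (x : EuclideanSpace ℝ (Fin (w 0))) (hZ : ∀ l ≤ N, l2 (layer φ W' x l) ≤ Z) {l : ℕ}
    (hl : l < N) :
    C * (√(w (l + 1) : ℝ) * l2 (preact φ W x l - preact φ W' x l)) ≤
      e * l2 (layer φ W x l - layer φ W' x l) + C * (ρ * Z) := by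
  have hw : (0 : ℝ) < √(w (l + 1) : ℝ) := by
    have := hw0 (l + 1) hl
    positivity
  have h1 : √(w (l + 1) : ℝ) • (preact φ W x l - preact φ W' x l) =
      W l *ᵥ (layer φ W x l - layer φ W' x l) + (W l - W' l) *ᵥ layer φ W' x l := by
    rw [Matrix.mulVec_sub, Matrix.sub_mulVec, sub_add_sub_cancel]
    ext p
    simp only [preact, Pi.smul_apply, Pi.sub_apply, smul_eq_mul]
    field_simp
  have h2 : √(w (l + 1) : ℝ) * l2 (preact φ W x l - preact φ W' x l) ≤
      l2 (W l *ᵥ (layer φ W x l - layer φ W' x l)) + ρ * Z := by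
    nth_rw 1 [← abs_of_pos hw]
    rw [← l2_smul, h1]
    refine (l2_add_le _ _).trans (add_le_add le_rfl ((l2_mulVec_le_frobNorm _ _).trans ?_))
    exact mul_le_mul (hρ l hl) (hZ l hl.le) (l2_nonneg _) hρ0
  calc _ ≤ C * (l2 (W l *ᵥ (layer φ W x l - layer φ W' x l)) + ρ * Z) := by gcongr
    _ ≤ _ := by rw [mul_add]; exact add_le_add (hW l hl _) le_rfl

/-- Errors obey `s ↦ e * s + C * ρ * Z`, whose fixed point bounds them uniformly in depth. -/
theorem l2_layer_sub_le (hφ : WellPosed φ C) (he : 0 ≤ e) (he1 : e ≤ 1) (hW : Stable C e W N)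
    (hw0 : ∀ l ≤ N, 0 < w l) {ρ Z : ℝ} (hρ0 : 0 ≤ ρ) (hρ : ∀ l < N, frobNorm (W l - W' l) ≤ ρ)
    (x : EuclideanSpace ℝ (Fin (w 0))) (hZ : ∀ l ≤ N, l2 (layer φ W' x l) ≤ Z) :
    ∀ l ≤ N, (1 - e) * l2 (layer φ W x l - layer φ W' x l) ≤ C * (ρ * Z) := by
  have hZ0 : 0 ≤ Z := (l2_nonneg _).trans (hZ 0 (Nat.zero_le _))
  intro l
  induction l with
  | zero =>
    intro _
    have h0 : layer φ W x 0 - layer φ W' x 0 = 0 := sub_self _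
    rw [h0, l2_zero, mul_zero]
    exact mul_nonneg hφ.nonneg (mul_nonneg hρ0 hZ0)
  | succ l ih =>
    intro hl
    have ih := ih (by omega)
    have h1 : l2 (layer φ W x (l + 1) - layer φ W' x (l + 1)) ≤
        C * l2 (preact φ W x l - preact φ W' x l) :=
      l2_le_mul_of_abs_le hφ.nonneg fun p => hφ.abs_sub_le _ _
    have h2 : l2 (preact φ W x l - preact φ W' x l) ≤
        √(w (l + 1) : ℝ) * l2 (preact φ W x l - preact φ W' x l) :=
      le_mul_of_one_le_left (l2_nonneg _) (Real.one_le_sqrt.2 (by exact_mod_cast hw0 _ hl))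
    have h3 := sqrt_mul_l2_preact_sub_le (φ := φ) hφ.nonneg hW hw0 hρ0 hρ x hZ
      (show l < N by omega)
    have h4 : l2 (layer φ W x (l + 1) - layer φ W' x (l + 1)) ≤
        e * l2 (layer φ W x l - layer φ W' x l) + C * (ρ * Z) :=
      h1.trans ((mul_le_mul_of_nonneg_left h2 hφ.nonneg).trans h3)
    nlinarith [mul_le_mul_of_nonneg_left h4 (sub_nonneg.2 he1), mul_le_mul_of_nonneg_left ih he]

theorem l2_preact_sub_le (hφ : WellPosed φ C) (hC : 0 < C) (he : 0 ≤ e) (he1 : e ≤ 1)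
    (hW : Stable C e W N)
    (hw0 : ∀ l ≤ N, 0 < w l) {ρ Z : ℝ} (hρ0 : 0 ≤ ρ) (hρ : ∀ l < N, frobNorm (W l - W' l) ≤ ρ)
    (x : EuclideanSpace ℝ (Fin (w 0))) (hZ : ∀ l ≤ N, l2 (layer φ W' x l) ≤ Z) {l : ℕ}
    (hl : l < N) :
    (1 - e) * (√(w (l + 1) : ℝ) * l2 (preact φ W x l - preact φ W' x l)) ≤ ρ * Z := by
  have h1 := sqrt_mul_l2_preact_sub_le (φ := φ) hC.le hW hw0 hρ0 hρ x hZ hl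
  have h2 := l2_layer_sub_le hφ he he1 hW hw0 hρ0 hρ x hZ l hl.le
  refine le_of_mul_le_mul_left ?_ hC
  nlinarith [mul_le_mul_of_nonneg_left h1 (sub_nonneg.2 he1), mul_le_mul_of_nonneg_left h2 he]

/-! ### Geometric decay of tangent vectors. -/

section pushTangent

variable (x : EuclideanSpace ℝ (Fin (w 0))) (src : (l : ℕ) → Fin (w (l + 1)) → ℝ)

theorem pushTangent_add (src' : (l : ℕ) → Fin (w (l + 1)) → ℝ) (l : ℕ) :
    pushTangent φ W x (src + src') l = pushTangent φ W x src l + pushTangent φ W x src' l := by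
  induction l with
  | zero => simp [pushTangent]
  | succ l ih =>
    ext p
    simp only [pushTangent, ih, Matrix.mulVec_add, Pi.add_apply]
    ring

theorem pushTangent_smul (c : ℝ) (l : ℕ) :
    pushTangent φ W x (c • src) l = c • pushTangent φ W x src l := by
  induction l with
  | zero => simp [pushTangent]
  | succ l ih =>
    ext p
    simp only [pushTangent, ih, Matrix.mulVec_smul, Pi.smul_apply, smul_eq_mul]
    ring

theorem sqrt_mul_l2_pushTangent_succ_le (hφ : WellPosed φ C) (hW : Stable C e W N)
    (hw0 : ∀ l ≤ N, 0 < w l) {l : ℕ} (hl : l < N) :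
    √(w (l + 1) : ℝ) * l2 (pushTangent φ W x src (l + 1)) ≤
      e * l2 (pushTangent φ W x src l) + C * l2 (src l) := by
  have hw : (0 : ℝ) < √(w (l + 1) : ℝ) := by
    have := hw0 (l + 1) hl
    positivity
  have h1 : l2 (√(w (l + 1) : ℝ) • pushTangent φ W x src (l + 1)) ≤
      C * l2 (W l *ᵥ pushTangent φ W x src l + src l) := by
    refine l2_le_mul_of_abs_le hφ.nonneg fun p => ?_
    have h2 : (√(w (l + 1) : ℝ) • pushTangent φ W x src (l + 1)) p =
        deriv φ (preact φ W x l p) * (W l *ᵥ pushTangent φ W x src l + src l) p := by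
      simp only [pushTangent, Pi.smul_apply, Pi.add_apply, smul_eq_mul]
      field_simp
    rw [h2, abs_mul]
    gcongr
    exact hφ.bound _
  rw [l2_smul, abs_of_pos hw] at h1
  refine h1.trans ((mul_le_mul_of_nonneg_left (l2_add_le _ _) hφ.nonneg).trans ?_)
  rw [mul_add]
  exact add_le_add (hW l hl _) le_rfl

theorem pushTangent_single_of_le {l : ℕ} (v : Fin (w (l + 1)) → ℝ) {m : ℕ} (hm : m ≤ l) :
    pushTangent φ W x (Pi.single l v) m = 0 := by
  induction m with
  | zero => rfl
  | succ m ih =>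
    ext p
    have h1 : (Pi.single l v : (l : ℕ) → Fin (w (l + 1)) → ℝ) m = 0 :=
      Pi.single_eq_of_ne (M := fun l => Fin (w (l + 1)) → ℝ) (by omega : m ≠ l) v
    simp [pushTangent, ih (by omega), h1]

theorem pushTangent_single_succ {l : ℕ} (v : Fin (w (l + 1)) → ℝ) :
    pushTangent φ W x (Pi.single l v) (l + 1) =
      fun p => deriv φ (preact φ W x l p) * (1 / √(w (l + 1) : ℝ) * v p) := by
  ext p
  simp [pushTangent, pushTangent_single_of_le x v le_rfl]

/-- After injection at layer `l + 1`, which costs `1 / √(w (l + 1))`, each layer contracts by `e`.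
Summing the one-step bounds gives `S ≤ e * S + C * l2 v` for the scaled total `S`, hence a bound
free of the depth. -/
theorem sum_l2_pushTangent_single_le (hφ : WellPosed φ C) (he : 0 ≤ e) (hW : Stable C e W N)
    (hw0 : ∀ l ≤ N, 0 < w l) {l : ℕ} (hl : l < N) (v : Fin (w (l + 1)) → ℝ) :
    (1 - e) * (√(w (l + 1) : ℝ) *
      ∑ m ∈ Finset.range (N + 1), l2 (pushTangent φ W x (Pi.single l v) m)) ≤ C * l2 v := by
  set g : ℕ → ℝ := fun m => l2 (pushTangent φ W x (Pi.single l v) m) with hg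
  set a : ℝ := √(w (l + 1) : ℝ) with ha
  have ha0 : 0 ≤ a := Real.sqrt_nonneg _
  have step : ∀ m < N, a * g (m + 1) ≤ e * (a * g m) + if m = l then C * l2 v else 0 := by
    intro m hm
    have h1 := sqrt_mul_l2_pushTangent_succ_le x (Pi.single l v) hφ hW hw0 hm
    by_cases hml : m = l
    · subst hml
      rw [if_pos rfl]
      rw [Pi.single_eq_same] at h1
      have : g m = 0 := by simp [hg, pushTangent_single_of_le x v le_rfl, l2_zero]
      rw [this]
      simpa [hg, pushTangent_single_of_le x v le_rfl, l2_zero] using h1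
    · have h2 : (Pi.single l v : (l : ℕ) → Fin (w (l + 1)) → ℝ) m = 0 :=
        Pi.single_eq_of_ne (M := fun l => Fin (w (l + 1)) → ℝ) hml v
      rw [h2, l2_zero, mul_zero, add_zero] at h1
      rw [if_neg hml, add_zero, mul_left_comm]
      refine mul_le_mul_of_nonneg_left (le_trans ?_ h1) ha0
      exact le_mul_of_one_le_left (l2_nonneg _) (Real.one_le_sqrt.2 (by exact_mod_cast hw0 _ hm))
  have h0 : g 0 = 0 := l2_zero
  have h1 : a * ∑ m ∈ Finset.range (N + 1), g m ≤
      e * (a * ∑ m ∈ Finset.range (N + 1), g m) + C * l2 v := by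
    calc a * ∑ m ∈ Finset.range (N + 1), g m = ∑ m ∈ Finset.range N, a * g (m + 1) := by
          rw [Finset.sum_range_succ', h0, add_zero, Finset.mul_sum]
      _ ≤ ∑ m ∈ Finset.range N, (e * (a * g m) + if m = l then C * l2 v else 0) :=
          Finset.sum_le_sum fun m hm => step m (Finset.mem_range.1 hm)
      _ = e * (a * ∑ m ∈ Finset.range N, g m) + C * l2 v := by
          rw [Finset.sum_add_distrib, Finset.mul_sum, Finset.mul_sum]
          simp [hl]
      _ ≤ _ := by
          rw [Finset.sum_range_succ]
          gcongr
          exact le_add_of_nonneg_right (l2_nonneg _)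
  linarith

end pushTangent

end estimates

/-! ### Tangent propagation as the derivative in the weights. -/

section derivative

variable {φ : ℝ → ℝ} {w : ℕ → ℕ} (W V : Weights w) (x : EuclideanSpace ℝ (Fin (w 0)))

theorem hasDerivAt_layer (hφ : Differentiable ℝ φ) (l : ℕ) :
    HasDerivAt (fun s : ℝ => layer φ (W + s • V) x l)
      (pushTangent φ W x (fun m => V m *ᵥ layer φ W x m) l) 0 := by
  induction l with
  | zero => exact hasDerivAt_const _ _
  | succ l ih =>
    rw [hasDerivAt_pi] at ih ⊢
    intro p
    have hW0 : W + (0 : ℝ) • V = W := by simp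
    have h1 : HasDerivAt (fun s : ℝ => preact φ (W + s • V) x l p)
        (1 / √(w (l + 1) : ℝ) * ((W l *ᵥ pushTangent φ W x (fun m => V m *ᵥ layer φ W x m) l) p +
          (V l *ᵥ layer φ W x l) p)) 0 := by
      have h5 : HasDerivAt
          (fun s : ℝ => ∑ j, (W l p j + s * V l p j) * layer φ (W + s • V) x l j)
          (∑ j, (W l p j * pushTangent φ W x (fun m => V m *ᵥ layer φ W x m) l j +
            V l p j * layer φ W x l j)) 0 := by
        refine HasDerivAt.fun_sum fun j _ => ?_
        have h2 : HasDerivAt (fun s : ℝ => W l p j + s * V l p j) (V l p j) 0 := by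
          simpa using ((hasDerivAt_id (0 : ℝ)).mul_const (V l p j)).const_add (W l p j)
        have h3 := h2.mul (ih j)
        rw [hW0] at h3
        refine h3.congr_deriv ?_
        ring
      rw [Finset.sum_add_distrib] at h5
      exact h5.const_mul _
    have h4 : HasDerivAt φ (deriv φ (preact φ W x l p)) (preact φ (W + (0 : ℝ) • V) x l p) := by
      rw [hW0]
      exact (hφ _).hasDerivAt
    exact h4.comp 0 h1

theorem continuous_layer (hφ : Continuous φ) (l : ℕ) : Continuous fun x => layer φ W x l := by
  induction l with
  | zero => exact PiLp.continuous_ofLp 2 _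
  | succ l ih =>
    refine continuous_pi fun p => hφ.comp (continuous_const.mul ?_)
    exact (continuous_apply p).comp (Continuous.matrix_mulVec continuous_const ih)

/-- Continuity in the input supplies the measurability needed to integrate gradients against the
input distribution. -/
theorem continuous_pushTangent (hφ : Continuous φ) (hφ' : Continuous (deriv φ))
    (src : (l : ℕ) → Fin (w (l + 1)) → ℝ) (l : ℕ) :
    Continuous fun x => pushTangent φ W x src l := by
  induction l with
  | zero => exact continuous_const
  | succ l ih =>
    refine continuous_pi fun p => Continuous.mul (hφ'.comp (continuous_const.mul ?_))
      (continuous_const.mul (Continuous.add ?_ continuous_const))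
    · exact (continuous_apply p).comp
        (Continuous.matrix_mulVec continuous_const (continuous_layer W hφ l))
    · exact (continuous_apply p).comp (Continuous.matrix_mulVec continuous_const ih)

end derivative

/-! ### Responses of the output and factorisation of the kernel. -/

/-- The derivative of the output with respect to the argument of the activation of layer `l + 1`,
scaled like the weights of that layer. -/
def outMap (φ : ℝ → ℝ) {w : ℕ → ℕ} (h K no : ℕ) (W : Weights w)
    (x : EuclideanSpace ℝ (Fin (w 0))) (l : ℕ) : (Fin (w (l + 1)) → ℝ) →ₗ[ℝ] (Fin no → ℝ) where
  toFun v := (1 / √(totalWidth w h K : ℝ)) • ∑ k ∈ Finset.range (K + 1),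
    shortcut no (w (k * h)) *ᵥ pushTangent φ W x (Pi.single l v) (k * h)
  map_add' v u := by
    simp only [Pi.single_add, pushTangent_add, Matrix.mulVec_add, Finset.sum_add_distrib, smul_add]
  map_smul' c v := by
    have : (Pi.single l (c • v) : (l : ℕ) → Fin (w (l + 1)) → ℝ) = c • Pi.single l v :=
      Pi.single_smul (f := fun l => Fin (w (l + 1)) → ℝ) l c v
    simp only [this, pushTangent_smul, Matrix.mulVec_smul, ← Finset.smul_sum, RingHom.id_apply]
    rw [smul_comm]

theorem outMap_apply (φ : ℝ → ℝ) {w : ℕ → ℕ} (h K no : ℕ) (W : Weights w)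
    (x : EuclideanSpace ℝ (Fin (w 0))) (l : ℕ) (v : Fin (w (l + 1)) → ℝ) :
    outMap φ h K no W x l v = (1 / √(totalWidth w h K : ℝ)) • ∑ k ∈ Finset.range (K + 1),
      shortcut no (w (k * h)) *ᵥ pushTangent φ W x (Pi.single l v) (k * h) := rfl

/-- The contribution of layer `l + 1` itself to `outMap`, without the scaling of the output. -/
def directMap (φ : ℝ → ℝ) {w : ℕ → ℕ} (no : ℕ) (W : Weights w)
    (x : EuclideanSpace ℝ (Fin (w 0))) (l : ℕ) (v : Fin (w (l + 1)) → ℝ) : Fin no → ℝ :=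
  shortcut no (w (l + 1)) *ᵥ
    fun p => deriv φ (preact φ W x l p) * (1 / √(w (l + 1) : ℝ) * v p)

/-- The responses of the output to the columns of the matrix of layer `l + 1`. -/
def responseMatrix (φ : ℝ → ℝ) {w : ℕ → ℕ} (h K no : ℕ) (W : Weights w)
    (x : EuclideanSpace ℝ (Fin (w 0))) (l : ℕ) : Matrix (Fin (w l)) (Fin no) ℝ :=
  Matrix.of fun q => outMap φ h K no W x l fun p => W l p q

section formulas

variable {φ : ℝ → ℝ} {w : ℕ → ℕ} {h K no : ℕ} (W : Weights w) (x : EuclideanSpace ℝ (Fin (w 0)))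

theorem hasDerivAt_net (hφ : Differentiable ℝ φ) (V : Weights w) :
    HasDerivAt (fun s : ℝ => net φ h K no (W + s • V) x)
      (WithLp.toLp 2 ((1 / √(totalWidth w h K : ℝ)) • ∑ k ∈ Finset.range (K + 1),
        shortcut no (w (k * h)) *ᵥ
          pushTangent φ W x (fun m => V m *ᵥ layer φ W x m) (k * h))) 0 := by
  refine (PiLp.continuousLinearEquiv 2 ℝ (fun _ : Fin no => ℝ)).symm.hasFDerivAt.comp_hasDerivAt
    0 (HasDerivAt.fun_const_smul _ (HasDerivAt.fun_sum fun k _ => ?_))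
  exact (Matrix.mulVecLin (shortcut no (w (k * h)))).toContinuousLinearMap.hasFDerivAt.comp_hasDerivAt
    0 (hasDerivAt_layer W V x hφ (k * h))

/-- Moving the entry `(p, j)` injects the tangent source `z_j • e_p` at layer `l + 1` and nothing
elsewhere. -/
theorem partialW_eq (hφ : Differentiable ℝ φ) (l : ℕ) (p : Fin (w (l + 1))) (j : Fin (w l)) :
    partialW φ h K no W l p j x =
      WithLp.toLp 2 (layer φ W x l j • outMap φ h K no W x l (Pi.single p 1)) := by
  have h1 : ∀ s : ℝ, Function.update W l (W l + Matrix.single p j s) =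
      W + s • (Pi.single l (Matrix.single p j 1) : Weights w) := by
    intro s
    ext m : 1
    by_cases hm : m = l
    · subst hm
      simp
    · simp [hm]
  have h2 : (fun m => (Pi.single l (Matrix.single p j 1) : Weights w) m *ᵥ layer φ W x m) =
      Pi.single l (layer φ W x l j • Pi.single p 1) := by
    ext m : 1
    by_cases hm : m = l
    · subst hm
      simp [Matrix.single_mulVec]
      ext i
      simp [Function.update_apply, Pi.single_apply]
    · simp [hm]
  rw [partialW]
  simp only [h1]
  rw [(hasDerivAt_net W x hφ _).deriv, h2, ← map_smul]
  rfl

/-- Multiplication by `(W l)ᵀ` recombines the responses to basis vectors, by linearity, into the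
response to column `q` of `W l`. -/
theorem scaledGradW_apply (hφ : Differentiable ℝ φ) (l : ℕ) (q j : Fin (w l)) (o : Fin no) :
    scaledGradW φ h K no W l x (q, j) o =
      layer φ W x l j * responseMatrix φ h K no W x l q o := by
  have h1 : (fun p => W l p q) = ∑ p, W l p q • Pi.single p (1 : ℝ) := by
    ext p
    simp [Finset.sum_apply, Pi.single_apply]
  rw [scaledGradW, Matrix.mul_apply, Fintype.sum_prod_type, responseMatrix, Matrix.of_apply, h1,
    map_sum, Finset.sum_apply, Finset.mul_sum]
  refine Finset.sum_congr rfl fun p _ => ?_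
  simp only [Matrix.blockDiagonal_apply, gradW, Matrix.of_apply, partialW_eq W x hφ]
  simp
  ring

/-- The scaled gradient is a tensor product of layer vector and response matrix, so its Gram matrix
factors. -/
theorem ntk_eq (hφ : Differentiable ℝ φ) (x' : EuclideanSpace ℝ (Fin (w 0))) :
    ntk φ h K no W x x' = ∑ k ∈ Finset.Icc 1 K,
      (∑ j, layer φ W x (k * h - 1) j * layer φ W x' (k * h - 1) j) •
        ((responseMatrix φ h K no W x (k * h - 1))ᵀ *
          responseMatrix φ h K no W x' (k * h - 1)) := by
  refine Finset.sum_congr rfl fun k _ => ?_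
  ext o o'
  simp only [Matrix.mul_apply, Matrix.transpose_apply, Fintype.sum_prod_type, Matrix.smul_apply,
    scaledGradW_apply W _ hφ, smul_eq_mul, Finset.sum_mul_sum]
  rw [Finset.sum_comm]
  refine Finset.sum_congr rfl fun j _ => Finset.sum_congr rfl fun q _ => ?_
  ring

theorem continuous_outMap (hφ : Continuous φ) (hφ' : Continuous (deriv φ)) (l : ℕ)
    (v : Fin (w (l + 1)) → ℝ) : Continuous fun x => outMap φ h K no W x l v := by
  have h1 : Continuous fun x => ∑ k ∈ Finset.range (K + 1),
      shortcut no (w (k * h)) *ᵥ pushTangent φ W x (Pi.single l v) (k * h) := by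
    refine continuous_finsetSum _ fun k _ => ?_
    exact Continuous.matrix_mulVec continuous_const (continuous_pushTangent W hφ hφ' _ _)
  simp only [outMap_apply]
  exact h1.const_smul (1 / √(totalWidth w h K : ℝ))

end formulas

theorem sum_comp_le_sum {ι κ : Type*} {s : Finset ι} {t : Finset κ} {g : κ → ℝ} {i : ι → κ}
    (hg : ∀ m ∈ t, 0 ≤ g m) (hi : Set.InjOn i s) (hst : ∀ k ∈ s, i k ∈ t) :
    ∑ k ∈ s, g (i k) ≤ ∑ m ∈ t, g m := by
  classical
  rw [← Finset.sum_image hi]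
  exact Finset.sum_le_sum_of_subset_of_nonneg (Finset.image_subset_iff.2 hst)
    fun m hm _ => hg m hm

theorem totalWidth_eq {w : ℕ → ℕ} {h K n : ℕ} (hw : ∀ k ≤ K, w (k * h) = n) :
    totalWidth w h K = (K + 1) * n := by
  rw [totalWidth, Finset.sum_congr rfl fun k hk => hw k (by simpa [Nat.lt_succ_iff] using hk)]
  simp

/-! ### Size of the responses for stable weights. -/

section estimates

variable {φ : ℝ → ℝ} {C e : ℝ} {w : ℕ → ℕ} {h K n no : ℕ} {W : Weights w}

theorem l2_outMap_le (hφ : WellPosed φ C) (he : 0 ≤ e) (he1 : e ≤ 1) (hh : 1 ≤ h)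
    (hW : Stable C e W (K * h)) (hw0 : ∀ l ≤ K * h, 0 < w l)
    (x : EuclideanSpace ℝ (Fin (w 0))) {l : ℕ} (hl : l < K * h) (v : Fin (w (l + 1)) → ℝ) :
    (1 - e) * (√(totalWidth w h K : ℝ) * (√(w (l + 1) : ℝ) * l2 (outMap φ h K no W x l v))) ≤
      C * l2 v := by
  have hb := sum_l2_pushTangent_single_le x hφ he hW hw0 hl v
  set g : ℕ → ℝ := fun m => l2 (pushTangent φ W x (Pi.single l v) m) with hg
  have h1 : √(totalWidth w h K : ℝ) * l2 (outMap φ h K no W x l v) ≤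
      ∑ m ∈ Finset.range (K * h + 1), g m := by
    have h2 : l2 (outMap φ h K no W x l v) = 1 / √(totalWidth w h K : ℝ) *
        l2 (∑ k ∈ Finset.range (K + 1),
          shortcut no (w (k * h)) *ᵥ pushTangent φ W x (Pi.single l v) (k * h)) := by
      rw [outMap_apply, l2_smul, abs_of_nonneg (by positivity)]
    rw [h2, ← mul_assoc]
    refine (mul_le_of_le_one_left (l2_nonneg _) ?_).trans ?_
    · rw [mul_one_div]
      exact div_self_le_one _
    · refine (l2_sum_le _ _).trans ((Finset.sum_le_sum fun k _ => l2_shortcut_mulVec_le _).trans ?_)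
      refine sum_comp_le_sum (g := g) (i := fun k => k * h) (fun m _ => l2_nonneg _) ?_ ?_
      · intro a _ b _ hab
        exact Nat.eq_of_mul_eq_mul_right hh hab
      · intro k hk
        simp only [Finset.mem_range, Nat.lt_succ_iff] at hk ⊢
        exact Nat.mul_le_mul_right h hk
  refine le_trans ?_ hb
  have h3 : 0 ≤ 1 - e := by linarith
  rw [mul_left_comm (√(totalWidth w h K : ℝ))]
  exact mul_le_mul_of_nonneg_left (mul_le_mul_of_nonneg_left h1 (Real.sqrt_nonneg _)) h3

/-- Injection costs `1 / √n`, and a tangent arriving at any other shortcut layer has paid a further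
`1 / √n`. Hence the factor `n`, against `√n` for the direct contribution. -/
theorem l2_outMap_sub_directMap_le (hφ : WellPosed φ C) (he : 0 ≤ e) (he1 : e ≤ 1) (hh : 1 ≤ h)
    (hn : 0 < n) (hw : ∀ k ≤ K, w (k * h) = n)
    (hW : Stable C e W (K * h)) (hw0 : ∀ l ≤ K * h, 0 < w l)
    (x : EuclideanSpace ℝ (Fin (w 0))) {l k₀ : ℕ} (hk₀ : k₀ ≤ K) (hl : k₀ * h = l + 1)
    (v : Fin (w (l + 1)) → ℝ) :
    (1 - e) * (n * l2 (√(totalWidth w h K : ℝ) • outMap φ h K no W x l v -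
      directMap φ no W x l v)) ≤ C * l2 v := by
  have hlK : l < K * h := by
    have := Nat.mul_le_mul_right h hk₀
    omega
  have hb := sum_l2_pushTangent_single_le x hφ he hW hw0 hlK v
  have hwl : w (l + 1) = n := hl ▸ hw k₀ hk₀
  have hwl' : √(w (l + 1) : ℝ) = √(n : ℝ) := by rw [hwl]
  rw [hwl'] at hb
  set t : ℕ → Fin no → ℝ := fun m =>
    shortcut no (w m) *ᵥ pushTangent φ W x (Pi.single l v) m with ht
  set g : ℕ → ℝ := fun m => l2 (pushTangent φ W x (Pi.single l v) m) with hg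
  have hM : 0 < (totalWidth w h K : ℝ) := by
    rw [totalWidth_eq hw]; positivity
  have h1 : √(totalWidth w h K : ℝ) • outMap φ h K no W x l v =
      ∑ k ∈ Finset.range (K + 1), t (k * h) := by
    rw [outMap_apply, smul_smul, mul_one_div_cancel (by positivity), one_smul]
  have h2 : directMap φ no W x l v = t (k₀ * h) := by
    rw [hl]
    simp only [ht, directMap, pushTangent_single_succ]
  have h3 : √(totalWidth w h K : ℝ) • outMap φ h K no W x l v - directMap φ no W x l v =
      ∑ k ∈ (Finset.range (K + 1)).erase k₀, t (k * h) := by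
    rw [h1, h2, sub_eq_iff_eq_add, Finset.sum_erase_add]
    simpa [Nat.lt_succ_iff] using hk₀
  -- The last step into layer `k * h` supplies `1 / √n` and leaves the tangent at layer `k * h - 1`.
  -- The case `k = 0` is separated since truncated subtraction would merge it with `k = 1` when `h =
  -- 1`.
  have h4 : ∀ k ∈ (Finset.range (K + 1)).erase k₀, √(n : ℝ) * l2 (t (k * h)) ≤
      if k = 0 then 0 else g (k * h - 1) := by
    intro k hk
    simp only [Finset.mem_erase, Finset.mem_range, Nat.lt_succ_iff] at hk
    refine (mul_le_mul_of_nonneg_left (l2_shortcut_mulVec_le _) (Real.sqrt_nonneg _)).trans ?_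
    split_ifs with hk0
    · subst hk0
      have : pushTangent φ W x (Pi.single l v) (0 * h) = 0 :=
        pushTangent_single_of_le x v (by simp)
      simp [this, l2_zero]
    · obtain ⟨m, hm⟩ : ∃ m, k * h = m + 1 :=
        Nat.exists_eq_add_one.2 (Nat.mul_pos (Nat.pos_of_ne_zero hk0) hh)
      have hmK : m < K * h := by
        have := Nat.mul_le_mul_right h hk.2
        omega
      have hml : m ≠ l := by
        rintro rfl
        exact hk.1 (Nat.eq_of_mul_eq_mul_right hh (hm.trans hl.symm))
      have h5 := sqrt_mul_l2_pushTangent_succ_le x (Pi.single l v) hφ hW hw0 hmK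
      rw [Pi.single_eq_of_ne (M := fun l => Fin (w (l + 1)) → ℝ) hml v, l2_zero, mul_zero,
        add_zero, ← hm, show √(w (k * h) : ℝ) = √(n : ℝ) by rw [hw k hk.2]] at h5
      refine h5.trans ?_
      rw [hm, Nat.add_sub_cancel]
      exact mul_le_of_le_one_left (l2_nonneg _) he1
  have h5 : √(n : ℝ) * l2 (∑ k ∈ (Finset.range (K + 1)).erase k₀, t (k * h)) ≤
      ∑ m ∈ Finset.range (K * h + 1), g m := by
    calc _ ≤ √(n : ℝ) * ∑ k ∈ (Finset.range (K + 1)).erase k₀, l2 (t (k * h)) := by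
          gcongr
          exact l2_sum_le _ _
      _ ≤ ∑ k ∈ (Finset.range (K + 1)).erase k₀, if k = 0 then 0 else g (k * h - 1) := by
          rw [Finset.mul_sum]
          exact Finset.sum_le_sum h4
      _ ≤ ∑ k ∈ Finset.range (K + 1), if k = 0 then 0 else g (k * h - 1) := by
          refine Finset.sum_le_sum_of_subset_of_nonneg (Finset.erase_subset _ _) fun k _ _ => ?_
          split_ifs
          exacts [le_rfl, l2_nonneg _]
      _ = ∑ k ∈ Finset.range K, g ((k + 1) * h - 1) := by
          rw [Finset.sum_range_succ']
          simp
      _ ≤ _ := by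
          refine sum_comp_le_sum (g := g) (i := fun k => (k + 1) * h - 1)
            (fun m _ => l2_nonneg _) ?_ ?_
          · intro a _ b _ hab
            have ha := Nat.mul_pos (Nat.succ_pos a) hh
            have hb := Nat.mul_pos (Nat.succ_pos b) hh
            have : (a + 1) * h = (b + 1) * h := by
              simp only [Nat.succ_eq_add_one] at ha hb
              dsimp only at hab
              omega
            exact Nat.succ_injective (Nat.eq_of_mul_eq_mul_right hh this)
          · intro k hk
            have h6 := Nat.mul_le_mul_right h (Nat.succ_le_of_lt (Finset.mem_range.1 hk))
            simp only [Finset.mem_range, Nat.succ_eq_add_one] at h6 ⊢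
            omega
  rw [h3]
  refine le_trans ?_ hb
  have h6 : 0 ≤ 1 - e := by linarith
  refine mul_le_mul_of_nonneg_left ?_ h6
  nth_rw 1 [← Real.mul_self_sqrt (Nat.cast_nonneg n), mul_assoc]
  exact mul_le_mul_of_nonneg_left h5 (Real.sqrt_nonneg _)

end estimates

/-! ### Frobenius and trace bounds for products. -/

section matrix

variable {p q r : ℕ}

theorem frobNorm_add_le (A B : Matrix (Fin p) (Fin q) ℝ) :
    frobNorm (A + B) ≤ frobNorm A + frobNorm B := by
  simp only [frobNorm_eq_l2]
  exact l2_add_le _ _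

theorem frobNorm_smul (c : ℝ) (A : Matrix (Fin p) (Fin q) ℝ) :
    frobNorm (c • A) = |c| * frobNorm A := by
  simp only [frobNorm_eq_l2, ← l2_smul]
  rfl

theorem frobNorm_transpose (A : Matrix (Fin p) (Fin q) ℝ) : frobNorm Aᵀ = frobNorm A := by
  rw [frobNorm, frobNorm, Finset.sum_comm]
  rfl

/-- Fits the response matrix, whose rows are images of the columns of the weight matrix. -/
theorem mul_frobNorm_le_of_rows {A : Matrix (Fin q) (Fin r) ℝ} {B : Matrix (Fin p) (Fin q) ℝ}
    {a c : ℝ} (ha : 0 ≤ a) (hc : 0 ≤ c) (hAB : ∀ j, a * l2 (A j) ≤ c * l2 fun i => B i j) :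
    a * frobNorm A ≤ c * frobNorm B := by
  refine (pow_le_pow_iff_left₀ (mul_nonneg ha (frobNorm_nonneg _))
    (mul_nonneg hc (frobNorm_nonneg _)) two_ne_zero).1 ?_
  rw [← frobNorm_transpose B, mul_pow, mul_pow, frobNorm_sq, frobNorm_sq, Finset.mul_sum,
    Finset.mul_sum]
  refine Finset.sum_le_sum fun j _ => ?_
  rw [← l2_sq (A j), ← l2_sq (Bᵀ j), ← mul_pow, ← mul_pow]
  exact pow_le_pow_left₀ (mul_nonneg ha (l2_nonneg _)) (hAB j) 2

theorem mul_frobNorm_transpose_mul_le {A : Matrix (Fin p) (Fin q) ℝ}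
    {a c : ℝ} (ha : 0 ≤ a) (hc : 0 ≤ c) (hA : ∀ v, a * l2 (Aᵀ *ᵥ v) ≤ c * l2 v)
    (B : Matrix (Fin p) (Fin r) ℝ) : a * frobNorm (Aᵀ * B) ≤ c * frobNorm B := by
  rw [← frobNorm_transpose (Aᵀ * B)]
  refine mul_frobNorm_le_of_rows ha hc fun j => ?_
  exact hA fun i => B i j

theorem abs_trace_transpose_mul_le (A B : Matrix (Fin p) (Fin q) ℝ) :
    |(Aᵀ * B).trace| ≤ frobNorm A * frobNorm B := by
  rw [frobNorm_eq_l2, frobNorm_eq_l2]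
  convert abs_dotProduct_le (fun ij : Fin p × Fin q => A ij.1 ij.2) (fun ij => B ij.1 ij.2) using 2
  rw [Fintype.sum_prod_type, Finset.sum_comm]
  rfl

theorem abs_trace_transpose_mul_sub_le (A B A' B' : Matrix (Fin p) (Fin q) ℝ) :
    |(Aᵀ * B).trace - (A'ᵀ * B').trace| ≤
      frobNorm (A - A') * frobNorm B + frobNorm A' * frobNorm (B - B') := by
  have h1 : (Aᵀ * B).trace - (A'ᵀ * B').trace =
      ((A - A')ᵀ * B).trace + (A'ᵀ * (B - B')).trace := by
    rw [Matrix.transpose_sub, Matrix.sub_mul, Matrix.mul_sub, Matrix.trace_sub, Matrix.trace_sub]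
    ring
  rw [h1]
  exact (abs_add_le _ _).trans
    (add_le_add (abs_trace_transpose_mul_le _ _) (abs_trace_transpose_mul_le _ _))

theorem l2_shortcut_mulVec_mul_le {no m : ℕ} {a : Fin m → ℝ} {b : ℝ} (hb : 0 ≤ b)
    (hab : ∀ i, |a i| ≤ b) (v : Fin m → ℝ) :
    √(m : ℝ) * l2 (shortcut no m *ᵥ fun i => a i * (1 / √(m : ℝ) * v i)) ≤ b * l2 v := by
  refine (mul_le_mul_of_nonneg_left (l2_shortcut_mulVec_le _) (Real.sqrt_nonneg _)).trans ?_
  have h1 : l2 (fun i => a i * (1 / √(m : ℝ) * v i)) ≤ b * l2 ((1 / √(m : ℝ)) • v) := by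
    refine l2_le_mul_of_abs_le hb fun i => ?_
    rw [abs_mul]
    exact mul_le_mul_of_nonneg_right (hab i) (abs_nonneg _)
  rw [l2_smul, abs_of_nonneg (by positivity)] at h1
  refine (mul_le_mul_of_nonneg_left h1 (Real.sqrt_nonneg _)).trans ?_
  have h2 : √(m : ℝ) * (1 / √(m : ℝ)) ≤ 1 := by
    rw [mul_one_div]
    exact div_self_le_one _
  calc √(m : ℝ) * (b * (1 / √(m : ℝ) * l2 v)) = √(m : ℝ) * (1 / √(m : ℝ)) * (b * l2 v) := by ring
    _ ≤ _ := mul_le_of_le_one_left (mul_nonneg hb (l2_nonneg _)) h2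

end matrix

/-! ### Size and perturbation of the response matrices. -/

section estimates

variable {φ : ℝ → ℝ} {C e : ℝ} {w : ℕ → ℕ} {h K n no : ℕ} {W W' : Weights w}

theorem transpose_responseMatrix_mulVec (x : EuclideanSpace ℝ (Fin (w 0))) (l : ℕ)
    (v : Fin (w l) → ℝ) :
    (responseMatrix φ h K no W x l)ᵀ *ᵥ v = outMap φ h K no W x l (W l *ᵥ v) := by
  have h1 : W l *ᵥ v = ∑ q, v q • fun p => W l p q := by
    ext p
    simp [Matrix.mulVec, dotProduct, mul_comm]
  rw [h1, map_sum]
  ext o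
  simp [Matrix.mulVec, dotProduct, responseMatrix, mul_comm]

theorem frobNorm_responseMatrix_le (hφ : WellPosed φ C) (he : 0 ≤ e) (he1 : e ≤ 1) (hh : 1 ≤ h)
    (hn : 0 < n) (hW : Stable C e W (K * h)) (hw0 : ∀ l ≤ K * h, 0 < w l)
    (x : EuclideanSpace ℝ (Fin (w 0))) {l : ℕ} (hl : l < K * h) (hwl : w (l + 1) = n) :
    (1 - e) * (√(totalWidth w h K : ℝ) * frobNorm (responseMatrix φ h K no W x l)) ≤ 1 := by
  have hs : (0 : ℝ) < √(n : ℝ) := by positivity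
  have hC := hφ.nonneg
  have h0 : 0 ≤ 1 - e := by linarith
  have h1 : ((1 - e) * (√(totalWidth w h K : ℝ) * √(n : ℝ))) *
      frobNorm (responseMatrix φ h K no W x l) ≤ C * frobNorm (W l) := by
    refine mul_frobNorm_le_of_rows (by positivity) hC fun q => ?_
    refine le_trans (le_of_eq ?_)
      (l2_outMap_le (no := no) hφ he he1 hh hW hw0 x hl fun p => W l p q)
    rw [show √(w (l + 1) : ℝ) = √(n : ℝ) by rw [hwl], mul_assoc, mul_assoc]
    rfl
  have h2 := frobNorm_le_of_mulVec_le hC (hW l hl) he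
  rw [show √(w (l + 1) : ℝ) = √(n : ℝ) by rw [hwl]] at h2
  refine le_of_mul_le_mul_left ?_ hs
  nlinarith [h1, h2]

/-- The transpose factors through `W l`, and `C * ‖W l‖ ≤ 1` absorbs the constant. The operator norm
gains `√n` over `frobNorm_responseMatrix_le`; this makes the kernel small in Frobenius norm. -/
theorem l2_transpose_responseMatrix_mulVec_le (hφ : WellPosed φ C) (he : 0 ≤ e) (he1 : e ≤ 1)
    (hh : 1 ≤ h) (hW : Stable C e W (K * h)) (hw0 : ∀ l ≤ K * h, 0 < w l)
    (x : EuclideanSpace ℝ (Fin (w 0))) {l : ℕ} (hl : l < K * h) (hwl : w (l + 1) = n)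
    (v : Fin (w l) → ℝ) :
    (1 - e) * (√(totalWidth w h K : ℝ) * √(n : ℝ)) *
      l2 ((responseMatrix φ h K no W x l)ᵀ *ᵥ v) ≤ 1 * l2 v := by
  rw [transpose_responseMatrix_mulVec]
  have h1 := l2_outMap_le (no := no) hφ he he1 hh hW hw0 x hl (W l *ᵥ v)
  rw [show √(w (l + 1) : ℝ) = √(n : ℝ) by rw [hwl]] at h1
  have h2 := hW l hl v
  have h3 := mul_le_of_le_one_left (l2_nonneg v) he1
  linarith

/-- The three terms come from the change of `deriv φ` in the direct part, the change of `W l` in the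
direct part, and the two indirect parts, each small without any comparison between them. -/
theorem frobNorm_responseMatrix_sub_le (hφ : WellPosed φ C) (hC : 0 < C) (he : 0 ≤ e)
    (he1 : e < 1) (hh : 1 ≤ h) (hn : 0 < n) (hw : ∀ k ≤ K, w (k * h) = n)
    (hW : Stable C e W (K * h)) (hW' : Stable C e W' (K * h)) (hw0 : ∀ l ≤ K * h, 0 < w l)
    (x : EuclideanSpace ℝ (Fin (w 0))) {l k₀ : ℕ} (hk₀ : k₀ ≤ K) (hl : k₀ * h = l + 1)
    {τ ρ : ℝ} (hτ0 : 0 ≤ τ)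
    (hτ : ∀ p, |deriv φ (preact φ W x l p) - deriv φ (preact φ W' x l p)| ≤ τ)
    (hρ : frobNorm (W l - W' l) ≤ ρ) :
    √(totalWidth w h K : ℝ) *
      frobNorm (responseMatrix φ h K no W x l - responseMatrix φ h K no W' x l) ≤
      τ / C + C * ρ + 2 / ((1 - e) * √(n : ℝ)) := by
  have hs : (0 : ℝ) < √(n : ℝ) := by positivity
  have hs1 : 1 ≤ √(n : ℝ) := Real.one_le_sqrt.2 (by exact_mod_cast hn)
  have hss : √(n : ℝ) * √(n : ℝ) = n := Real.mul_self_sqrt (Nat.cast_nonneg n)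
  have h0 : 0 < 1 - e := by linarith
  have hlK : l < K * h := by
    have := Nat.mul_le_mul_right h hk₀
    omega
  have hwl : w (l + 1) = n := hl ▸ hw k₀ hk₀
  have hwl' : √(w (l + 1) : ℝ) = √(n : ℝ) := by rw [hwl]
  have rest : ∀ U : Weights w, Stable C e U (K * h) →
      frobNorm (Matrix.of fun q : Fin (w l) => √(totalWidth w h K : ℝ) •
        outMap φ h K no U x l (fun p => U l p q) - directMap φ no U x l fun p => U l p q) ≤
        1 / ((1 - e) * √(n : ℝ)) := by
    intro U hU
    have h1 := mul_frobNorm_le_of_rows (A := Matrix.of fun q : Fin (w l) =>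
        √(totalWidth w h K : ℝ) • outMap φ h K no U x l (fun p => U l p q) -
          directMap φ no U x l fun p => U l p q) (B := U l)
      (a := (1 - e) * n) (c := C) (by positivity) hC.le fun q => by
        rw [mul_assoc]
        exact l2_outMap_sub_directMap_le hφ he he1.le hh hn hw hU hw0 x hk₀ hl _
    have h2 := frobNorm_le_of_mulVec_le hC.le (hU l hlK) he
    rw [hwl'] at h2
    rw [le_div_iff₀ (by positivity)]
    refine le_of_mul_le_mul_left ?_ hs
    refine le_trans (le_of_eq ?_) (h1.trans (h2.trans (mul_le_mul_of_nonneg_left he1.le hs.le)))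
    rw [← hss]
    simp only [Real.sqrt_mul_self hs.le]
    ring
  set E₁ : Matrix (Fin (w l)) (Fin no) ℝ := Matrix.of fun q => shortcut no (w (l + 1)) *ᵥ fun p =>
    (deriv φ (preact φ W x l p) - deriv φ (preact φ W' x l p)) *
      (1 / √(w (l + 1) : ℝ) * W' l p q) with hE₁
  set E₂ : Matrix (Fin (w l)) (Fin no) ℝ := Matrix.of fun q => shortcut no (w (l + 1)) *ᵥ fun p =>
    deriv φ (preact φ W x l p) * (1 / √(w (l + 1) : ℝ) * (W l - W' l) p q) with hE₂
  have hb₁ : frobNorm E₁ ≤ τ / C := by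
    have h1 : √(n : ℝ) * frobNorm E₁ ≤ τ * frobNorm (W' l) := by
      rw [← hwl']
      exact mul_frobNorm_le_of_rows (Real.sqrt_nonneg _) hτ0 fun q =>
        l2_shortcut_mulVec_mul_le hτ0 hτ _
    have h2 := frobNorm_le_of_mulVec_le hC.le (hW' l hlK) he
    rw [hwl'] at h2
    rw [le_div_iff₀ hC]
    refine le_of_mul_le_mul_left ?_ hs
    nlinarith [mul_le_mul_of_nonneg_left h1 hC.le, mul_le_mul_of_nonneg_left h2 hτ0,
      mul_le_of_le_one_right (mul_nonneg hτ0 hs.le) he1.le]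
  have hb₂ : frobNorm E₂ ≤ C * ρ := by
    have h1 : √(n : ℝ) * frobNorm E₂ ≤ C * frobNorm (W l - W' l) := by
      rw [← hwl']
      exact mul_frobNorm_le_of_rows (Real.sqrt_nonneg _) hC.le fun q =>
        l2_shortcut_mulVec_mul_le hC.le (fun p => hφ.bound _) _
    nlinarith [frobNorm_nonneg E₂, mul_le_mul_of_nonneg_left hρ hC.le]
  have hdecomp : √(totalWidth w h K : ℝ) •
      (responseMatrix φ h K no W x l - responseMatrix φ h K no W' x l) = E₁ + E₂ +
      ((Matrix.of fun q : Fin (w l) => √(totalWidth w h K : ℝ) •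
        outMap φ h K no W x l (fun p => W l p q) - directMap φ no W x l fun p => W l p q) -
      (Matrix.of fun q : Fin (w l) => √(totalWidth w h K : ℝ) •
        outMap φ h K no W' x l (fun p => W' l p q) - directMap φ no W' x l fun p => W' l p q)) := by
    have h1 : E₁ + E₂ = (Matrix.of fun q : Fin (w l) => directMap φ no W x l fun p => W l p q) -
        (Matrix.of fun q : Fin (w l) => directMap φ no W' x l fun p => W' l p q) := by
      refine funext fun q => ?_
      change shortcut _ _ *ᵥ _ + shortcut _ _ *ᵥ _ = shortcut _ _ *ᵥ _ - shortcut _ _ *ᵥ _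
      rw [← Matrix.mulVec_add, ← Matrix.mulVec_sub]
      congr 1
      ext p
      simp only [Pi.add_apply, Pi.sub_apply, Matrix.sub_apply]
      ring
    rw [h1]
    ext q o
    simp only [responseMatrix, Matrix.smul_apply, Matrix.sub_apply, Matrix.add_apply,
      Matrix.of_apply, Pi.sub_apply, Pi.smul_apply, smul_eq_mul]
    ring
  rw [← abs_of_nonneg (Real.sqrt_nonneg (totalWidth w h K : ℝ)), ← frobNorm_smul, hdecomp]
  refine (frobNorm_add_le _ _).trans
    (add_le_add ((frobNorm_add_le _ _).trans (add_le_add hb₁ hb₂)) ?_)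
  refine (frobNorm_sub_le _ _).trans ((add_le_add (rest W hW) (rest W' hW')).trans (le_of_eq ?_))
  ring

end estimates

/-! ### Size and perturbation of the kernel. -/

theorem abs_dotProduct_sub_le {ι : Type*} [Fintype ι] {a b a' b' : ι → ℝ} {R s : ℝ}
    (hb : l2 b ≤ R) (ha' : l2 a' ≤ R) (ha : l2 (a - a') ≤ s) (hbb : l2 (b - b') ≤ s) :
    |(∑ i, a i * b i) - ∑ i, a' i * b' i| ≤ 2 * (R * s) := by
  have h1 : (∑ i, a i * b i) - ∑ i, a' i * b' i =
      (∑ i, (a - a') i * b i) + ∑ i, a' i * (b - b') i := by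
    rw [← Finset.sum_sub_distrib, ← Finset.sum_add_distrib]
    refine Finset.sum_congr rfl fun i _ => ?_
    simp only [Pi.sub_apply]
    ring
  rw [h1]
  have h2 := (abs_dotProduct_le (a - a') b).trans
    (mul_le_mul ha hb (l2_nonneg _) ((l2_nonneg _).trans ha))
  have h3 := (abs_dotProduct_le a' (b - b')).trans
    (mul_le_mul ha' hbb (l2_nonneg _) ((l2_nonneg _).trans ha'))
  linarith [abs_add_le (∑ i, (a - a') i * b i) (∑ i, a' i * (b - b') i)]

theorem sum_Icc_le_of_le_div {K : ℕ} {f : ℕ → ℝ} {Q : ℝ} (hQ : 0 ≤ Q)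
    (hf : ∀ k ∈ Finset.Icc 1 K, f k ≤ Q / (K + 1)) : ∑ k ∈ Finset.Icc 1 K, f k ≤ Q := by
  refine (Finset.sum_le_card_nsmul _ _ _ hf).trans ?_
  rw [Nat.card_Icc, Nat.add_sub_cancel, nsmul_eq_mul, mul_div_assoc', div_le_iff₀ (by positivity)]
  nlinarith

section estimates

variable {φ : ℝ → ℝ} {C e : ℝ} {w : ℕ → ℕ} {h K n no : ℕ} {W W' : Weights w}

theorem frobNorm_ntk_le (hφ : WellPosed φ C) (he : 0 ≤ e)
    (he1 : e < 1) (hh : 1 ≤ h) (hn : 0 < n) (hw : ∀ k ≤ K, w (k * h) = n)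
    (hW : Stable C e W (K * h)) (hw0 : ∀ l ≤ K * h, 0 < w l)
    (x x' : EuclideanSpace ℝ (Fin (w 0))) {Z : ℝ} (hZ0 : 0 ≤ Z)
    (hx : ∀ l ≤ K * h, l2 (layer φ W x l) ≤ Z * √(n : ℝ))
    (hx' : ∀ l ≤ K * h, l2 (layer φ W x' l) ≤ Z * √(n : ℝ)) :
    frobNorm (ntk φ h K no W x x') ≤ Z ^ 2 / ((1 - e) ^ 2 * √(n : ℝ)) := by
  have hs : (0 : ℝ) < √(n : ℝ) := by positivity
  have hss : √(n : ℝ) * √(n : ℝ) = n := Real.mul_self_sqrt (Nat.cast_nonneg n)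
  have h0 : 0 < 1 - e := by linarith
  have hM : (totalWidth w h K : ℝ) = (K + 1) * n := by
    rw [totalWidth_eq hw]; push_cast; ring
  have hM0 : (0 : ℝ) < (totalWidth w h K : ℝ) := by rw [hM]; positivity
  have hr : 0 < √(totalWidth w h K : ℝ) := by positivity
  have hrr := Real.mul_self_sqrt hM0.le
  rw [ntk_eq W x hφ.differentiable]
  refine (frobNorm_sum_le _ _).trans (sum_Icc_le_of_le_div (by positivity) fun k hk => ?_)
  rw [Finset.mem_Icc] at hk
  have hkh : k * h = k * h - 1 + 1 := by
    have := Nat.mul_pos (show 0 < k by omega) hh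
    omega
  have hl : k * h - 1 < K * h := by
    have := Nat.mul_le_mul_right h hk.2
    omega
  have hwl : w (k * h - 1 + 1) = n := hkh ▸ hw k hk.2
  have h1 := mul_frobNorm_transpose_mul_le (A := responseMatrix φ h K no W x (k * h - 1))
    (by positivity) zero_le_one
    (l2_transpose_responseMatrix_mulVec_le (no := no) hφ he he1.le hh hW hw0 x hl hwl)
    (responseMatrix φ h K no W x' (k * h - 1))
  have h2 := frobNorm_responseMatrix_le (no := no) hφ he he1.le hh hn hW hw0 x' hl hwl
  have h3 := (abs_dotProduct_le (layer φ W x (k * h - 1)) (layer φ W x' (k * h - 1))).trans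
    (mul_le_mul (hx _ hl.le) (hx' _ hl.le) (l2_nonneg _) (by positivity))
  rw [frobNorm_smul]
  set r := √(totalWidth w h K : ℝ)
  set s := √(n : ℝ)
  set F := frobNorm (responseMatrix φ h K no W x' (k * h - 1))
  set G := frobNorm ((responseMatrix φ h K no W x (k * h - 1))ᵀ *
    responseMatrix φ h K no W x' (k * h - 1))
  -- Operator bound on one factor times Frobenius bound on the other. With `r * r = (K + 1) * n`,
  -- the `n` cancels against `⟨z, z'⟩` and `K + 1` against the number of summands, leaving `1 / √n`.
  have hG : G ≤ 1 / ((1 - e) ^ 2 * (r * r) * s) := by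
    rw [le_div_iff₀ (by positivity)]
    have := mul_le_mul_of_nonneg_left h1 (by positivity : 0 ≤ (1 - e) * r)
    linarith
  calc _ ≤ (Z * s * (Z * s)) * (1 / ((1 - e) ^ 2 * (r * r) * s)) :=
        mul_le_mul h3 hG (frobNorm_nonneg _) (by positivity)
    _ = _ := by
        rw [hrr, hM, ← hss]
        field_simp

/-- Each summand is a scalar of order `n` times a trace of order `1 / ((K + 1) * n)`. Perturbing
both factors by the product rule gives a change of order `1 / (K + 1)` per layer times the relative
errors. -/
theorem abs_trace_ntk_sub_le (hφ : WellPosed φ C) (hC : 0 < C) (he : 0 ≤ e)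
    (he1 : e < 1) (hh : 1 ≤ h) (hn : 0 < n) (hw : ∀ k ≤ K, w (k * h) = n)
    (hW : Stable C e W (K * h)) (hW' : Stable C e W' (K * h)) (hw0 : ∀ l ≤ K * h, 0 < w l)
    {ρ : ℝ} (hρ : ∀ l < K * h, frobNorm (W l - W' l) ≤ ρ)
    {Z σ τ : ℝ} (hZ0 : 0 ≤ Z) (hσ0 : 0 ≤ σ) (hτ0 : 0 ≤ τ) (hρ0 : 0 ≤ ρ)
    {S : Set (EuclideanSpace ℝ (Fin (w 0)))}
    (hZ : ∀ x ∈ S, ∀ l ≤ K * h, l2 (layer φ W x l) ≤ Z * √(n : ℝ))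
    (hZ' : ∀ x ∈ S, ∀ l ≤ K * h, l2 (layer φ W' x l) ≤ Z * √(n : ℝ))
    (hσ : ∀ x ∈ S, ∀ l ≤ K * h, l2 (layer φ W x l - layer φ W' x l) ≤ σ * √(n : ℝ))
    (hτ : ∀ x ∈ S, ∀ k ≤ K, ∀ l, k * h = l + 1 → ∀ p,
      |deriv φ (preact φ W x l p) - deriv φ (preact φ W' x l p)| ≤ τ)
    {x x' : EuclideanSpace ℝ (Fin (w 0))} (hx : x ∈ S) (hx' : x' ∈ S) :
    |(ntk φ h K no W x x').trace - (ntk φ h K no W' x x').trace| ≤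
      2 * Z ^ 2 * (τ / C + C * ρ + 2 / ((1 - e) * √(n : ℝ))) / (1 - e) +
        2 * Z * σ / (1 - e) ^ 2 := by
  have hs : (0 : ℝ) < √(n : ℝ) := by positivity
  have hss : √(n : ℝ) * √(n : ℝ) = n := Real.mul_self_sqrt (Nat.cast_nonneg n)
  have h0 : 0 < 1 - e := by linarith
  have hM : (totalWidth w h K : ℝ) = (K + 1) * n := by
    rw [totalWidth_eq hw]; push_cast; ring
  have hM0 : (0 : ℝ) < (totalWidth w h K : ℝ) := by rw [hM]; positivity
  have hr : 0 < √(totalWidth w h K : ℝ) := by positivity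
  have hrr := Real.mul_self_sqrt hM0.le
  rw [ntk_eq W x hφ.differentiable, ntk_eq W' x hφ.differentiable, Matrix.trace_sum,
    Matrix.trace_sum, ← Finset.sum_sub_distrib]
  refine (Finset.abs_sum_le_sum_abs _ _).trans
    (sum_Icc_le_of_le_div (by positivity) fun k hk => ?_)
  rw [Finset.mem_Icc] at hk
  have hkh : k * h = k * h - 1 + 1 := by
    have := Nat.mul_pos (show 0 < k by omega) hh
    omega
  have hl : k * h - 1 < K * h := by
    have := Nat.mul_le_mul_right h hk.2
    omega
  have hwl : w (k * h - 1 + 1) = n := hkh ▸ hw k hk.2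
  set D := τ / C + C * ρ + 2 / ((1 - e) * √(n : ℝ)) with hD
  have hD0 : 0 ≤ D := by positivity
  have hA : ∀ y ∈ S, ∀ U : Weights w, Stable C e U (K * h) →
      frobNorm (responseMatrix φ h K no U y (k * h - 1)) ≤
        1 / ((1 - e) * √(totalWidth w h K : ℝ)) := fun y _ U hU => by
    rw [le_div_iff₀ (by positivity)]
    have := frobNorm_responseMatrix_le (no := no) hφ he he1.le hh hn hU hw0 y hl hwl
    linarith
  have hd : ∀ y ∈ S, frobNorm (responseMatrix φ h K no W y (k * h - 1) -
      responseMatrix φ h K no W' y (k * h - 1)) ≤ D / √(totalWidth w h K : ℝ) := fun y hy => by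
    rw [le_div_iff₀ hr, mul_comm]
    exact frobNorm_responseMatrix_sub_le hφ hC he he1 hh hn hw hW hW' hw0 y hk.2 hkh hτ0
      (hτ y hy k hk.2 _ hkh) (hρ _ hl)
  have ht := (abs_trace_transpose_mul_sub_le (responseMatrix φ h K no W x (k * h - 1))
    (responseMatrix φ h K no W x' (k * h - 1)) (responseMatrix φ h K no W' x (k * h - 1))
    (responseMatrix φ h K no W' x' (k * h - 1))).trans (add_le_add
      (mul_le_mul (hd x hx) (hA x' hx' W hW) (frobNorm_nonneg _) (by positivity))
      (mul_le_mul (hA x hx W' hW') (hd x' hx') (frobNorm_nonneg _) (by positivity)))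
  have ht' := (abs_trace_transpose_mul_le (responseMatrix φ h K no W' x (k * h - 1))
    (responseMatrix φ h K no W' x' (k * h - 1))).trans
      (mul_le_mul (hA x hx W' hW') (hA x' hx' W' hW') (frobNorm_nonneg _) (by positivity))
  have hS := (abs_dotProduct_le (layer φ W x (k * h - 1)) (layer φ W x' (k * h - 1))).trans
    (mul_le_mul (hZ x hx _ hl.le) (hZ x' hx' _ hl.le) (l2_nonneg _) (by positivity))
  have hS' := abs_dotProduct_sub_le (hZ x' hx' _ hl.le) (hZ' x hx _ hl.le) (hσ x hx _ hl.le)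
    (hσ x' hx' _ hl.le)
  rw [Matrix.trace_smul, Matrix.trace_smul, smul_eq_mul, smul_eq_mul]
  set r := √(totalWidth w h K : ℝ)
  set s := √(n : ℝ)
  generalize (∑ j, layer φ W x (k * h - 1) j * layer φ W x' (k * h - 1) j) = a at *
  generalize (∑ j, layer φ W' x (k * h - 1) j * layer φ W' x' (k * h - 1) j) = a' at *
  generalize ((responseMatrix φ h K no W x (k * h - 1))ᵀ *
    responseMatrix φ h K no W x' (k * h - 1)).trace = b at *
  generalize ((responseMatrix φ h K no W' x (k * h - 1))ᵀ *
    responseMatrix φ h K no W' x' (k * h - 1)).trace = b' at *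
  calc |a * b - a' * b'| = |a * (b - b') + (a - a') * b'| := by ring_nf
    _ ≤ |a| * |b - b'| + |a - a'| * |b'| := by
        rw [← abs_mul, ← abs_mul]
        exact abs_add_le _ _
    _ ≤ (Z * s * (Z * s)) * (D / r * (1 / ((1 - e) * r)) + 1 / ((1 - e) * r) * (D / r)) +
        2 * (Z * s * (σ * s)) * (1 / ((1 - e) * r) * (1 / ((1 - e) * r))) := by
        gcongr
    _ = (s * s) / (r * r) * (2 * Z ^ 2 * D / (1 - e) + 2 * Z * σ / (1 - e) ^ 2) := by
        field_simp
        ring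
    _ = _ := by
        rw [hrr, hss, hM]
        field_simp

end estimates

/-! ### Tools for following the flow in time. -/

/-- The majorant `g` need not be measurable: a derivative always is, and lower integrals are
monotone and commute with finite constants. This suits training directions with no regularity in
time. -/
theorem norm_sub_le_of_lintegral_deriv_le {E : Type*} [NormedAddCommGroup E] [NormedSpace ℝ E]
    [CompleteSpace E] [SecondCountableTopology E] {f f' : ℝ → E} {g : ℝ → ℝ≥0∞} {T t c M : ℝ}
    (hf : ∀ s ∈ Icc 0 T, HasDerivWithinAt f (f' s) (Icc 0 T) s) (ht : t ∈ Icc 0 T) (hc : 0 ≤ c)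
    (hM : 0 ≤ M) (hg : ∀ s ∈ Ioo 0 t, ‖f' s‖ₑ ≤ ENNReal.ofReal c * g s)
    (hgM : ∫⁻ s in Icc 0 T, g s ≤ ENNReal.ofReal M) : ‖f t - f 0‖ ≤ c * M := by
  borelize E
  have hderiv : ∀ s ∈ Ioo 0 t, HasDerivAt f (f' s) s := fun s hs =>
    (hf s ⟨hs.1.le, hs.2.le.trans ht.2⟩).hasDerivAt (Icc_mem_nhds hs.1 (hs.2.trans_le ht.2))
  have hlin : ∫⁻ s in Ioc 0 t, ‖deriv f s‖ₑ ≤ ENNReal.ofReal (c * M) := by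
    rw [← setLIntegral_congr (Ioo_ae_eq_Ioc (μ := volume) (a := (0 : ℝ)) (b := t))]
    calc ∫⁻ s in Ioo 0 t, ‖deriv f s‖ₑ ≤ ∫⁻ s in Ioo 0 t, ENNReal.ofReal c * g s :=
          setLIntegral_mono' measurableSet_Ioo fun s hs => by
            rw [(hderiv s hs).deriv]
            exact hg s hs
      _ = ENNReal.ofReal c * ∫⁻ s in Ioo 0 t, g s := lintegral_const_mul' _ _ ENNReal.ofReal_ne_top
      _ ≤ ENNReal.ofReal c * ENNReal.ofReal M := by
          gcongr
          exact (lintegral_mono_set (Ioo_subset_Icc_self.trans (Icc_subset_Icc_right ht.2))).trans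
            hgM
      _ = _ := (ENNReal.ofReal_mul hc).symm
  have hint : IntegrableOn (deriv f) (Ioc 0 t) :=
    ⟨(stronglyMeasurable_deriv f).aestronglyMeasurable, hlin.trans_lt ENNReal.ofReal_lt_top⟩
  rw [← intervalIntegral.integral_eq_sub_of_hasDerivAt_of_le ht.1
    (fun s hs => ((hf s ⟨hs.1, hs.2.trans ht.2⟩).continuousWithinAt).mono
      (Icc_subset_Icc_right ht.2))
    (fun s hs => (hderiv s hs).differentiableAt.hasDerivAt)
    ((intervalIntegrable_iff_integrableOn_Ioc_of_le ht.1).2 hint),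
    intervalIntegral.integral_of_le ht.1]
  have h1 := (enorm_integral_le_lintegral_enorm (μ := volume.restrict (Ioc 0 t)) (deriv f)).trans
    hlin
  rw [← ofReal_norm] at h1
  exact (ENNReal.ofReal_le_ofReal_iff (mul_nonneg hc hM)).1 h1

/-- Bootstrap: the times at which a bound fails form a compact set, and its least element
contradicts `hstep`. The start is included, since at `t = 0` the premise of `hstep` is vacuous. -/
theorem forall_lt_of_forall_Ico_lt {N : ℕ} {T η : ℝ} {g : ℕ → ℝ → ℝ}
    (hg : ∀ l < N, ContinuousOn (g l) (Icc 0 T))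
    (hstep : ∀ t ∈ Icc 0 T, (∀ s ∈ Ico 0 t, ∀ l < N, g l s < η) → ∀ l < N, g l t < η) :
    ∀ t ∈ Icc 0 T, ∀ l < N, g l t < η := by
  by_contra! hcon
  obtain ⟨t₀, ht₀, l₀, hl₀, hgt₀⟩ := hcon
  set bad : Set ℝ := ⋃ l ∈ Finset.range N, Icc 0 T ∩ g l ⁻¹' Ici η with hbad
  have hmem : ∀ t, t ∈ bad ↔ t ∈ Icc 0 T ∧ ∃ l < N, η ≤ g l t := by
    intro t
    simp only [hbad, mem_iUnion, Finset.mem_range, mem_inter_iff, mem_preimage, mem_Ici]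
    constructor
    · rintro ⟨l, hl, h1, h2⟩
      exact ⟨h1, l, hl, h2⟩
    · rintro ⟨h1, l, hl, h2⟩
      exact ⟨l, hl, h1, h2⟩
  have hclosed : IsClosed bad := by
    refine isClosed_biUnion_finset fun l hl => ?_
    exact (hg l (Finset.mem_range.1 hl)).preimage_isClosed_of_isClosed isClosed_Icc isClosed_Ici
  have hcompact : IsCompact bad :=
    isCompact_Icc.of_isClosed_subset hclosed fun t ht => ((hmem t).1 ht).1
  obtain ⟨t, ht, hmin⟩ := hcompact.exists_isLeast ⟨t₀, (hmem t₀).2 ⟨ht₀, l₀, hl₀, hgt₀⟩⟩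
  obtain ⟨htT, l, hl, hlt⟩ := (hmem t).1 ht
  refine absurd (hstep t htT (fun s hs m hm => ?_) l hl) (not_lt.2 hlt)
  by_contra hge
  exact absurd (hmin ((hmem s).2 ⟨⟨hs.1, hs.2.le.trans htT.2⟩, m, hm, not_lt.1 hge⟩)) (not_le.2 hs.2)

theorem integral_mul_le_eLpNorm_mul_eLpNorm {α : Type*} [MeasurableSpace α] {μ : Measure α}
    {f g : α → ℝ} (hf : MemLp f 2 μ) (hg : MemLp g 2 μ) :
    ∫ x, f x * g x ∂μ ≤ (eLpNorm f 2 μ).toReal * (eLpNorm g 2 μ).toReal := by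
  have h1 : ∫ x, f x * g x ∂μ = inner ℝ (hf.toLp f) (hg.toLp g) := by
    rw [L2.inner_def]
    refine integral_congr_ae ?_
    filter_upwards [hf.coeFn_toLp, hg.coeFn_toLp] with x h2 h3
    simp [h2, h3, mul_comm]
  rw [h1, ← Lp.norm_toLp f hf, ← Lp.norm_toLp g hg]
  exact real_inner_le_norm _ _

/-! ### Weights stay near initialisation under the gradient flow. -/

section flow

variable {φ : ℝ → ℝ} {C e : ℝ} {w : ℕ → ℕ} {h K n no : ℕ} {W : Weights w}

/-- Duality: pairing the velocity `V` with itself turns the sum over entries into one response to `V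
*ᵥ z`, bounded without loss in the widths; Cauchy-Schwarz in the input follows. -/
theorem frobNorm_innerD_partialW_le (hφ : WellPosed φ C) (hφ' : Continuous (deriv φ)) (he : 0 ≤ e)
    (he1 : e < 1) (hh : 1 ≤ h) (hW : Stable C e W (K * h)) (hw0 : ∀ l ≤ K * h, 0 < w l)
    {A R : ℝ} (hA0 : 0 ≤ A) (hA : ∀ x, ∀ l ≤ K * h, l2 (layer φ W x l) ≤ ‖x‖ + A)
    {D : Measure (EuclideanSpace ℝ (Fin (w 0)))} [IsProbabilityMeasure D]
    (hR : eLpNorm (fun x : EuclideanSpace ℝ (Fin (w 0)) => x) 2 D ≤ ENNReal.ofReal R)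
    (hR0 : 0 ≤ R)
    {d : EuclideanSpace ℝ (Fin (w 0)) → EuclideanSpace ℝ (Fin no)} (hd : MemLp d 2 D)
    {l : ℕ} (hl : l < K * h) :
    (1 - e) * (√(totalWidth w h K : ℝ) *
      frobNorm (Matrix.of fun p j => innerD D (partialW φ h K no W l p j) d)) ≤
      C * ((R + A) * (eLpNorm d 2 D).toReal) := by
  set V : Matrix (Fin (w (l + 1))) (Fin (w l)) ℝ :=
    Matrix.of fun p j => innerD D (partialW φ h K no W l p j) d with hV
  have h0 : 0 < 1 - e := by linarith
  have hφc := hφ.differentiable.continuous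
  set r := √(totalWidth w h K : ℝ) with hr
  have hr0 : 0 ≤ r := Real.sqrt_nonneg _
  have hM : 0 < r := by
    refine Real.sqrt_pos.2 ?_
    have : w (0 * h) ≤ totalWidth w h K :=
      Finset.single_le_sum (f := fun k => w (k * h)) (fun _ _ => Nat.zero_le _) (by simp)
    have := hw0 (0 * h) (by simp)
    exact_mod_cast (by omega : 0 < totalWidth w h K)
  have hc0 : 0 ≤ C / ((1 - e) * r) := div_nonneg hφ.nonneg (by positivity)
  have hout : ∀ x v, l2 (outMap φ h K no W x l v) ≤ C / ((1 - e) * r) * l2 v := by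
    intro x v
    have h1 := l2_outMap_le (no := no) hφ he he1.le hh hW hw0 x hl v
    rw [div_mul_eq_mul_div, le_div_iff₀ (by positivity)]
    refine le_trans ?_ h1
    have h2 : 1 ≤ √(w (l + 1) : ℝ) := Real.one_le_sqrt.2 (by exact_mod_cast hw0 _ hl)
    have h3 := mul_le_mul_of_nonneg_left (le_mul_of_one_le_left
      (l2_nonneg (outMap φ h K no W x l v)) h2) (by positivity : 0 ≤ (1 - e) * r)
    linarith
  have hx2 : MemLp (fun x : EuclideanSpace ℝ (Fin (w 0)) => ‖x‖) 2 D :=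
    MemLp.norm ⟨aestronglyMeasurable_id, hR.trans_lt ENNReal.ofReal_lt_top⟩
  have hb2 : MemLp (fun x : EuclideanSpace ℝ (Fin (w 0)) => ‖x‖ + A) 2 D :=
    hx2.add (memLp_const A)
  have hbd : Integrable (fun x => (‖x‖ + A) * ‖d x‖) D := hb2.integrable_mul hd.norm
  have hbR : (eLpNorm (fun x : EuclideanSpace ℝ (Fin (w 0)) => ‖x‖ + A) 2 D).toReal ≤ R + A := by
    refine ENNReal.toReal_le_of_le_ofReal (by positivity) ?_
    refine (eLpNorm_add_le hx2.1 aestronglyMeasurable_const (by norm_num)).trans ?_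
    rw [ENNReal.ofReal_add hR0 hA0]
    refine add_le_add ?_ ?_
    · rw [eLpNorm_norm]
      exact hR
    · rw [eLpNorm_const _ (by norm_num) (IsProbabilityMeasure.ne_zero D)]
      simp [Real.enorm_eq_ofReal hA0]
  have hint : ∀ p j, Integrable (fun x => inner ℝ (partialW φ h K no W l p j x) (d x)) D := by
    intro p j
    have hcont : Continuous fun x => partialW φ h K no W l p j x := by
      simp only [partialW_eq W _ hφ.differentiable]
      refine (PiLp.continuous_toLp 2 _).comp ?_
      exact ((continuous_apply j).comp (continuous_layer W hφc l)).smul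
        (continuous_outMap W hφc hφ' l _)
    refine (hbd.const_mul (C / ((1 - e) * r) * l2 (Pi.single p 1 : Fin (w (l + 1)) → ℝ))).mono'
      (hcont.aestronglyMeasurable.inner hd.1) (Eventually.of_forall fun x => ?_)
    have h1 : ‖partialW φ h K no W l p j x‖ ≤
        (‖x‖ + A) * (C / ((1 - e) * r) * l2 (Pi.single p 1 : Fin (w (l + 1)) → ℝ)) := by
      rw [partialW_eq W x hφ.differentiable]
      change l2 _ ≤ _
      rw [l2_smul]
      exact mul_le_mul ((abs_le_l2 _ j).trans (hA x l hl.le)) (hout x _) (l2_nonneg _)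
        (by positivity)
    refine (norm_inner_le_norm _ _).trans ((mul_le_mul_of_nonneg_right h1 (norm_nonneg _)).trans
      (le_of_eq ?_))
    ring
  have hsum : ∀ x, ∑ p, ∑ j, V p j * inner ℝ (partialW φ h K no W l p j x) (d x) =
      inner ℝ (WithLp.toLp 2 (outMap φ h K no W x l (V *ᵥ layer φ W x l))) (d x) := by
    intro x
    have h1 : V *ᵥ layer φ W x l =
        ∑ p, ∑ j, (V p j * layer φ W x l j) • (Pi.single p 1 : Fin (w (l + 1)) → ℝ) := by
      ext p
      simp [Matrix.mulVec, dotProduct, Finset.sum_apply, Pi.single_apply]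
    rw [h1]
    simp only [map_sum, map_smul, WithLp.toLp_sum, WithLp.toLp_smul, sum_inner, inner_smul_left,
      partialW_eq W _ hφ.differentiable, conj_trivial, mul_assoc]
  have hswap : ∀ a : Fin (w (l + 1)) → Fin (w l) → ℝ,
      ∫ x, ∑ p, ∑ j, a p j * inner ℝ (partialW φ h K no W l p j x) (d x) ∂D =
        ∑ p, ∑ j, a p j * innerD D (partialW φ h K no W l p j) d := by
    intro a
    rw [integral_finsetSum _ fun p _ => integrable_finsetSum _ fun j _ =>
      (hint p j).const_mul (a p j)]
    refine Finset.sum_congr rfl fun p _ => ?_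
    rw [integral_finsetSum _ fun j _ => (hint p j).const_mul (a p j)]
    exact Finset.sum_congr rfl fun j _ => integral_const_mul _ _
  have hsq : frobNorm V ^ 2 ≤
      C / ((1 - e) * r) * frobNorm V * ((R + A) * (eLpNorm d 2 D).toReal) := by
    calc frobNorm V ^ 2 = ∑ p, ∑ j, V p j * innerD D (partialW φ h K no W l p j) d := by
          rw [frobNorm_sq]
          refine Finset.sum_congr rfl fun p _ => Finset.sum_congr rfl fun j _ => ?_
          rw [sq]
          rfl
      _ = ∫ x, inner ℝ (WithLp.toLp 2 (outMap φ h K no W x l (V *ᵥ layer φ W x l))) (d x) ∂D := by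
          simp only [← hsum]
          exact (hswap V).symm
      _ ≤ ∫ x, C / ((1 - e) * r) * frobNorm V * ((‖x‖ + A) * ‖d x‖) ∂D := by
          refine (Real.le_norm_self _).trans (norm_integral_le_of_norm_le (hbd.const_mul _)
            (Eventually.of_forall fun x => (norm_inner_le_norm _ _).trans ?_))
          rw [← mul_assoc]
          refine mul_le_mul_of_nonneg_right ((hout x _).trans ?_) (norm_nonneg _)
          rw [mul_assoc (C / ((1 - e) * r))]
          refine mul_le_mul_of_nonneg_left ((l2_mulVec_le_frobNorm _ _).trans ?_) hc0
          exact mul_le_mul_of_nonneg_left (hA x l hl.le) (frobNorm_nonneg _)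
      _ = C / ((1 - e) * r) * frobNorm V * ∫ x, (‖x‖ + A) * ‖d x‖ ∂D := integral_const_mul _ _
      _ ≤ _ := by
          gcongr
          · exact mul_nonneg hc0 (frobNorm_nonneg _)
          · refine (integral_mul_le_eLpNorm_mul_eLpNorm hb2 hd.norm).trans ?_
            rw [eLpNorm_norm]
            gcongr
  -- Cancel one factor of the norm, treating a zero velocity apart.
  have hfin : frobNorm V ≤ C / ((1 - e) * r) * ((R + A) * (eLpNorm d 2 D).toReal) := by
    rcases (frobNorm_nonneg V).eq_or_lt with hV0 | hV0
    · rw [← hV0]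
      positivity
    · nlinarith
  rw [div_mul_eq_mul_div, le_div_iff₀ (by positivity)] at hfin
  linarith

end flow

theorem hasDerivWithinAt_toLp {ι : Type*} [Fintype ι] {f : ℝ → ι → ℝ} {f' : ι → ℝ} {s : Set ℝ}
    {t : ℝ} (hf : ∀ i, HasDerivWithinAt (fun u => f u i) (f' i) s t) :
    HasDerivWithinAt (fun u => (WithLp.toLp 2 (f u) : EuclideanSpace ℝ ι)) (WithLp.toLp 2 f') s t :=
  (PiLp.continuousLinearEquiv 2 ℝ (fun _ : ι => ℝ)).symm.hasFDerivAt.comp_hasDerivWithinAt t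
    (hasDerivWithinAt_pi.2 hf)

theorem eLpNorm_id_le_of_lintegral_le {E : Type*} [NormedAddCommGroup E] [MeasurableSpace E]
    {D : Measure E} {R : ℝ} (hR : 0 ≤ R) (hD : ∫⁻ x, ‖x‖ₑ ^ 2 ∂D ≤ ENNReal.ofReal (R ^ 2)) :
    eLpNorm (fun x => x) 2 D ≤ ENNReal.ofReal R := by
  rw [eLpNorm_eq_lintegral_rpow_enorm_toReal two_ne_zero ENNReal.ofNat_ne_top]
  simp only [ENNReal.toReal_ofNat, ENNReal.rpow_ofNat]
  refine (ENNReal.rpow_le_rpow hD (by norm_num)).trans (le_of_eq ?_)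
  rw [ENNReal.ofReal_rpow_of_nonneg (sq_nonneg R) (by norm_num), ← Real.sqrt_eq_rpow,
    Real.sqrt_sq hR]

section flow

variable {φ : ℝ → ℝ} {C e ε : ℝ} {w : ℕ → ℕ} {h K n : ℕ}

theorem IsGradientFlow.stable_and_frobNorm_sub_le {no : ℕ} (hφ : WellPosed φ C)
    (hφ' : Continuous (deriv φ))
    (he : 0 ≤ e) (he1 : e < 1) (hh : 1 ≤ h) (hw0 : ∀ l ≤ K * h, 0 < w l)
    {A b R : ℝ} (hA0 : 0 ≤ A) (hb : ∀ l ≤ K * h, √(w l : ℝ) ≤ b)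
    (hA : |φ 0| * b ≤ (1 - e) * A)
    {D : Measure (EuclideanSpace ℝ (Fin (w 0)))} [IsProbabilityMeasure D]
    (hR : eLpNorm (fun x : EuclideanSpace ℝ (Fin (w 0)) => x) 2 D ≤ ENNReal.ofReal R)
    (hR0 : 0 ≤ R) {T M : ℝ} (hM : 0 ≤ M)
    {d : ℝ → EuclideanSpace ℝ (Fin (w 0)) → EuclideanSpace ℝ (Fin no)} {W : ℝ → Weights w}
    (hflow : IsGradientFlow φ h K no D T d W)
    (hW0 : ∀ l < K * h, StablePertinent C ε (W 0 l))
    (hd : totalDirection D T d ≤ ENNReal.ofReal M)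
    {c : ℝ} (hc : C * (R + A) / ((1 - e) * √(totalWidth w h K : ℝ)) = c)
    (hsmall : C * (c * M) < e - ε) :
    ∀ t ∈ Icc 0 T, Stable C e (W t) (K * h) ∧
      ∀ l < K * h, frobNorm (W t l - W 0 l) ≤ c * M := by
  have h0 : 0 < 1 - e := by linarith
  have hC := hφ.nonneg
  have hc0 : 0 ≤ c := by rw [← hc]; positivity
  have hS0 : Stable C ε (W 0) (K * h) := fun l hl v => by
    refine (mul_le_mul_of_nonneg_left (l2_mulVec_le_specNorm _ v) hC).trans ?_
    rw [← mul_assoc]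
    exact mul_le_mul_of_nonneg_right (hW0 l hl) (l2_nonneg v)
  have hMw : 0 < √(totalWidth w h K : ℝ) := by
    refine Real.sqrt_pos.2 ?_
    have : w (0 * h) ≤ totalWidth w h K :=
      Finset.single_le_sum (f := fun k => w (k * h)) (fun _ _ => Nat.zero_le _) (by simp)
    have := hw0 (0 * h) (by simp)
    exact_mod_cast (by omega : 0 < totalWidth w h K)
  have hstable : ∀ s, (∀ l < K * h, C * frobNorm (W s l - W 0 l) < e - ε) →
      Stable C e (W s) (K * h) := fun s hs => by
    have := hS0.of_frobNorm_sub_le hC fun l hl => (hs l hl).le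
    rwa [add_sub_cancel] at this
  have hfrob : ∀ l s, frobNorm (W s l - W 0 l) =
      ‖(WithLp.toLp 2 fun pj => W s l pj.1 pj.2 :
          EuclideanSpace ℝ (Fin (w (l + 1)) × Fin (w l))) -
        WithLp.toLp 2 fun pj => W 0 l pj.1 pj.2‖ := fun l s => frobNorm_eq_l2 _
  have hder : ∀ l < K * h, ∀ s ∈ Icc 0 T, HasDerivWithinAt
      (fun s => (WithLp.toLp 2 fun pj => W s l pj.1 pj.2 :
        EuclideanSpace ℝ (Fin (w (l + 1)) × Fin (w l))))
      (WithLp.toLp 2 fun pj => innerD D (partialW φ h K no (W s) l pj.1 pj.2) (d s))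
      (Icc 0 T) s :=
    fun l hl s hs => hasDerivWithinAt_toLp fun pj => hflow.flow s hs l hl pj.1 pj.2
  -- Stability strictly before `t` bounds the speed by `c * ‖d_s‖_D`, hence the displacement at `t`
  -- by `c * M`; `hsmall` makes this strictly smaller than the margin.
  have hstep : ∀ t ∈ Icc 0 T,
      (∀ s ∈ Ico 0 t, ∀ l < K * h, C * frobNorm (W s l - W 0 l) < e - ε) →
      ∀ l < K * h, frobNorm (W t l - W 0 l) ≤ c * M := by
    intro t ht hs l hl
    rw [hfrob]
    refine norm_sub_le_of_lintegral_deriv_le (hder l hl) ht hc0 hM (fun s hst => ?_) hd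
    have hsT : s ∈ Icc 0 T := ⟨hst.1.le, hst.2.le.trans ht.2⟩
    have hSs := hstable s (hs s ⟨hst.1.le, hst.2⟩)
    have hmem := hflow.memLp s hsT
    have h1 := frobNorm_innerD_partialW_le hφ hφ' he he1 hh hSs hw0 hA0
      (fun x => l2_layer_le hφ he he1.le hSs hw0 hb hA hA0 x) hR hR0 hmem hl
    have h2 : frobNorm (Matrix.of fun p j => innerD D (partialW φ h K no (W s) l p j) (d s)) ≤
        c * (eLpNorm (d s) 2 D).toReal := by
      rw [← hc, div_mul_eq_mul_div, le_div_iff₀ (by positivity)]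
      linarith
    rw [frobNorm_eq_l2] at h2
    rw [← ofReal_norm]
    refine (ENNReal.ofReal_le_ofReal h2).trans (le_of_eq ?_)
    rw [ENNReal.ofReal_mul hc0, ENNReal.ofReal_toReal hmem.2.ne]
  have hlt : ∀ t ∈ Icc 0 T, ∀ l < K * h, C * frobNorm (W t l - W 0 l) < e - ε := by
    refine forall_lt_of_forall_Ico_lt (fun l hl => ?_) fun t ht hs l hl =>
      (mul_le_mul_of_nonneg_left (hstep t ht hs l hl) hC).trans_lt hsmall
    simp only [hfrob]
    refine continuousOn_const.mul (ContinuousOn.norm (ContinuousOn.sub ?_ continuousOn_const))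
    exact fun s hs => (hder l hl s hs).continuousWithinAt
  exact fun t ht => ⟨hstable t (hlt t ht), hstep t ht fun s hs =>
    hlt s ⟨hs.1, hs.2.le.trans ht.2⟩⟩

theorem IsGradientFlow.ntk_sub_le (hφ : WellPosed φ C) (hC : 0 < C) (hφ' : Continuous (deriv φ))
    (he : 0 ≤ e) (he1 : e < 1) (hh : 1 ≤ h) (hn : 0 < n)
    (hw : ∀ k ≤ K, w (k * h) = n) (hw0 : ∀ l ≤ K * h, 0 < w l)
    {Cw CD B : ℝ} (hB : 0 ≤ B) (hCD0 : 0 ≤ CD) (hCw : ∀ l ≤ K * h, (w l : ℝ) ≤ Cw * n)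
    {D : Measure (EuclideanSpace ℝ (Fin (w 0)))} [IsProbabilityMeasure D]
    (hCD : ∫⁻ x, ‖x‖ₑ ^ 2 ∂D ≤ ENNReal.ofReal (CD * n))
    {T M : ℝ} (hT : 0 ≤ T) (hM : 0 ≤ M)
    {d : ℝ → EuclideanSpace ℝ (Fin (w 0)) → EuclideanSpace ℝ (Fin n)} {W : ℝ → Weights w}
    (hflow : IsGradientFlow φ h K n D T d W)
    (hW0 : ∀ l < K * h, StablePertinent C ε (W 0 l))
    (hd : totalDirection D T d ≤ ENNReal.ofReal M)
    {A Z ρ τ : ℝ} (hA : A = |φ 0| * √Cw / (1 - e)) (hZ : Z = B + A)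
    (hρ : ρ = C * (√CD + A) / (1 - e) * M / √(K + 1 : ℝ))
    (hsmall : C * ρ < e - ε) (hτ0 : 0 ≤ τ)
    (hτ : ∀ a b, |a| ≤ Z / C → |b| ≤ Z / C → |a - b| ≤ ρ * Z / (1 - e) →
      |deriv φ a - deriv φ b| ≤ τ)
    {t : ℝ} (ht : t ∈ Icc 0 T) {x x' : EuclideanSpace ℝ (Fin (w 0))}
    (hx : ‖x‖ ≤ B * √(n : ℝ)) (hx' : ‖x'‖ ≤ B * √(n : ℝ)) :
    frobNorm (ntk φ h K n (W t) x x' - ntk φ h K n (W 0) x x') ≤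
      2 * (Z ^ 2 / ((1 - e) ^ 2 * √(n : ℝ))) ∧
    |(ntk φ h K n (W t) x x').trace - (ntk φ h K n (W 0) x x').trace| ≤
      2 * Z ^ 2 * (τ / C + C * ρ + 2 / ((1 - e) * √(n : ℝ))) / (1 - e) +
        2 * Z * (C * (ρ * Z) / (1 - e)) / (1 - e) ^ 2 := by
  have h0 : 0 < 1 - e := by linarith
  have hs : (0 : ℝ) < √(n : ℝ) := by positivity
  have hA0 : 0 ≤ A := by rw [hA]; positivity
  have hZ0 : 0 ≤ Z := by rw [hZ]; positivity
  have hρ0 : 0 ≤ ρ := by rw [hρ]; positivity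
  have hb : ∀ l ≤ K * h, √(w l : ℝ) ≤ √Cw * √(n : ℝ) := fun l hl => by
    rw [← Real.sqrt_mul' _ (Nat.cast_nonneg n)]
    exact Real.sqrt_le_sqrt (hCw l hl)
  have hAb : |φ 0| * (√Cw * √(n : ℝ)) ≤ (1 - e) * (A * √(n : ℝ)) := by
    rw [hA]
    refine le_of_eq ?_
    field_simp
  have hR : eLpNorm (fun x : EuclideanSpace ℝ (Fin (w 0)) => x) 2 D ≤
      ENNReal.ofReal (√CD * √(n : ℝ)) := by
    refine eLpNorm_id_le_of_lintegral_le (by positivity) ?_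
    rw [mul_pow, Real.sq_sqrt hCD0, Real.sq_sqrt (Nat.cast_nonneg n)]
    exact hCD
  -- The `√n` of inputs and layers cancels against `√((K + 1) * n)`: only the number of shortcuts
  -- makes the displacement small.
  have hcM : C * (√CD * √(n : ℝ) + A * √(n : ℝ)) / ((1 - e) * √(totalWidth w h K : ℝ)) * M = ρ := by
    rw [hρ, totalWidth_eq hw]
    push_cast
    rw [Real.sqrt_mul (by positivity)]
    field_simp
  have key := hflow.stable_and_frobNorm_sub_le hφ hφ' he he1 hh hw0 (by positivity) hb hAb hR
    (by positivity) hM hW0 hd rfl (hcM ▸ hsmall)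
  rw [hcM] at key
  obtain ⟨hSt, hρt⟩ := key t ht
  obtain ⟨hS0, -⟩ := key 0 ⟨le_rfl, hT⟩
  set S : Set (EuclideanSpace ℝ (Fin (w 0))) := {y | ‖y‖ ≤ B * √(n : ℝ)} with hS
  have hlayer : ∀ U : Weights w, Stable C e U (K * h) → ∀ y ∈ S, ∀ l ≤ K * h,
      l2 (layer φ U y l) ≤ Z * √(n : ℝ) := fun U hU y hy l hl => by
    refine (l2_layer_le hφ he he1.le hU hw0 hb hAb (by positivity) y l hl).trans ?_
    rw [hZ, add_mul]
    exact add_le_add hy le_rfl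
  have hσ : ∀ y ∈ S, ∀ l ≤ K * h, l2 (layer φ (W t) y l - layer φ (W 0) y l) ≤
      C * (ρ * Z) / (1 - e) * √(n : ℝ) := fun y hy l hl => by
    have := l2_layer_sub_le hφ he he1.le hSt hw0 hρ0 hρt y (hlayer _ hS0 y hy) l hl
    rw [div_mul_eq_mul_div, le_div_iff₀ h0]
    linarith
  -- At a shortcut layer the factor `1 / √n` brings preactivations into an interval independent of
  -- the network size, as uniform continuity of `deriv φ` requires.
  have hpre : ∀ U : Weights w, Stable C e U (K * h) → ∀ y ∈ S, ∀ k ≤ K, ∀ l, k * h = l + 1 → ∀ p,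
      |preact φ U y l p| ≤ Z / C := fun U hU y hy k hk l hl p => by
    have hlK : l < K * h := by
      have := Nat.mul_le_mul_right h hk
      omega
    refine (abs_le_l2 _ p).trans ?_
    rw [le_div_iff₀ hC, l2_preact, show √(w (l + 1) : ℝ) = √(n : ℝ) by rw [← hl, hw k hk],
      mul_assoc, one_div_mul_eq_div, div_le_iff₀ hs, mul_comm (l2 _) C]
    exact (hU l hlK _).trans ((mul_le_of_le_one_left (l2_nonneg _) he1.le).trans
      (hlayer U hU y hy l hlK.le))
  have hdpre : ∀ y ∈ S, ∀ k ≤ K, ∀ l, k * h = l + 1 → ∀ p,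
      |preact φ (W t) y l p - preact φ (W 0) y l p| ≤ ρ * Z / (1 - e) := fun y hy k hk l hl p => by
    have hlK : l < K * h := by
      have := Nat.mul_le_mul_right h hk
      omega
    have h1 := l2_preact_sub_le hφ hC he he1.le hSt hw0 hρ0 hρt y (hlayer _ hS0 y hy) hlK
    rw [show √(w (l + 1) : ℝ) = √(n : ℝ) by rw [← hl, hw k hk]] at h1
    refine (abs_le_l2 (preact φ (W t) y l - preact φ (W 0) y l) p).trans ?_
    rw [le_div_iff₀ h0]
    refine le_of_mul_le_mul_left ?_ hs
    linarith
  constructor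
  · refine (frobNorm_sub_le _ _).trans ?_
    rw [two_mul]
    exact add_le_add
      (frobNorm_ntk_le hφ he he1 hh hn hw hSt hw0 x x' hZ0 (hlayer _ hSt x hx) (hlayer _ hSt x' hx'))
      (frobNorm_ntk_le hφ he he1 hh hn hw hS0 hw0 x x' hZ0 (hlayer _ hS0 x hx) (hlayer _ hS0 x' hx'))
  · exact abs_trace_ntk_sub_le hφ hC he he1 hh hn hw hSt hS0 hw0 hρt hZ0 (by positivity) hτ0 hρ0
      (hlayer _ hSt) (hlayer _ hS0) hσ
      (fun y hy k hk l hl p => hτ _ _ (hpre _ hSt y hy k hk l hl p) (hpre _ hS0 y hy k hk l hl p)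
        (hdpre y hy k hk l hl p)) hx hx'

end flow

theorem ntk_eq_zero_of_deriv_eq_zero {φ : ℝ → ℝ} (hφ : Differentiable ℝ φ)
    (hφ0 : ∀ x, deriv φ x = 0) {w : ℕ → ℕ} {h K no : ℕ} (W : Weights w)
    (x x' : EuclideanSpace ℝ (Fin (w 0))) : ntk φ h K no W x x' = 0 := by
  have h1 : ∀ src l, pushTangent φ W x src l = 0 := by
    intro src l
    cases l with
    | zero => rfl
    | succ l =>
      ext p
      simp [pushTangent, hφ0]
  have h2 : ∀ l, responseMatrix φ h K no W x l = 0 := by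
    intro l
    ext q o
    simp [responseMatrix, outMap_apply, h1]
  rw [ntk_eq W x hφ]
  simp [h2]

end DepthNTK

end

/-! ### Passage to the limit in probability. -/

theorem theorem4
    -- the activation
    (φ : ℝ → ℝ) (Cφ : ℝ) (hφ : DepthNTK.WellPosed φ Cφ) (hφ' : Continuous (deriv φ))
    (Lφ : ℝ≥0) (hLip : LipschitzWith Lφ φ)
    -- the constants
    (ε : ℝ) (hε0 : 0 < ε) (hε1 : ε < 1) (lam : ℝ) (hlam0 : 0 < lam) (hlam1 : lam < 1)
    (h : ℕ) (hh : 1 ≤ h) (T : ℝ) (hT : 0 ≤ T)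
    -- the number of shortcuts and the widths
    (K n : ℕ → ℕ) (w : ℕ → ℕ → ℕ)
    (hw : ∀ i, ∀ k ≤ K i, w i (k * h) = n i)
    (hw0 : ∀ i, ∀ l ≤ K i * h, 0 < w i l)
    (Cw : ℝ) (hw1 : ∀ i, ∀ l ≤ K i * h, (w i l : ℝ) ≤ Cw * n i)
    (hK : Tendsto K atTop atTop) (hn : Tendsto n atTop atTop)
    (hnK : (fun i => (K i : ℝ) ^ (2 / lam)) =O[atTop] fun i => (n i : ℝ))
    -- the input distributions
    (D : ∀ i, Measure (EuclideanSpace ℝ (Fin (w i 0)))) (hD : ∀ i, IsProbabilityMeasure (D i))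
    (CD : ℝ) (hD2 : ∀ i, ∫⁻ x, ‖x‖ₑ ^ 2 ∂(D i) ≤ ENNReal.ofReal (CD * n i))
    -- the random training directions and the random paths of the weights
    {Ω : ℕ → Type*} [∀ i, MeasurableSpace (Ω i)] (P : ∀ i, Measure (Ω i))
    (hP : ∀ i, IsProbabilityMeasure (P i))
    (d : ∀ i, Ω i → ℝ → EuclideanSpace ℝ (Fin (w i 0)) → EuclideanSpace ℝ (Fin (n i)))
    (W : ∀ i, Ω i → ℝ → DepthNTK.Weights (w i))
    (hSP : ∀ i, ∀ᵐ ω ∂(P i), ∀ l < K i * h, DepthNTK.StablePertinent Cφ ε (W i ω 0 l))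
    (hflow : ∀ i, ∀ᵐ ω ∂(P i),
      DepthNTK.IsGradientFlow φ h (K i) (n i) (D i) T (d i ω) (W i ω))
    (hd : DepthNTK.StochBounded P fun i ω => DepthNTK.totalDirection (D i) T (d i ω)) :
    ∀ B δ : ℝ, 0 < δ →
      Tendsto
        (fun i => P i {ω | ∃ t ∈ Icc 0 T, ∃ x x' : EuclideanSpace ℝ (Fin (w i 0)),
          ‖x‖ ≤ B * √(n i : ℝ) ∧ ‖x'‖ ≤ B * √(n i : ℝ) ∧
          (δ ≤ DepthNTK.frobNorm (DepthNTK.ntk φ h (K i) (n i) (W i ω t) x x' -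
                DepthNTK.ntk φ h (K i) (n i) (W i ω 0) x x') ∨
            δ ≤ |(DepthNTK.ntk φ h (K i) (n i) (W i ω t) x x').trace -
                (DepthNTK.ntk φ h (K i) (n i) (W i ω 0) x x').trace|)})
        atTop (𝓝 0) := by
  intro B δ hδ
  -- The estimates divide by `Cφ`; if it is zero, `φ` is constant and every kernel vanishes.
  rcases hφ.nonneg.eq_or_lt with hC0 | hC
  · have hφ0 : ∀ x, deriv φ x = 0 := fun x => by
      have := hφ.bound x
      rw [← hC0] at this
      exact abs_nonpos_iff.1 this
    refine tendsto_const_nhds.congr fun i => Eq.symm ?_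
    convert measure_empty (μ := P i)
    refine eq_empty_of_forall_notMem ?_
    rintro ω ⟨t, -, x, x', -, -, hbad⟩
    simp only [DepthNTK.ntk_eq_zero_of_deriv_eq_zero hφ.differentiable hφ0] at hbad
    rcases hbad with hbad | hbad
    · simp [DepthNTK.frobNorm] at hbad
      linarith
    · simp at hbad
      linarith
  have hnpos : ∀ i, 0 < n i := fun i => by
    have h1 := hw i 0 (Nat.zero_le _)
    have h2 := hw0 i (0 * h) (by simp)
    omega
  -- Midway between `ε` and 1: room for the weights to move while layers still contract.
  obtain ⟨e, he⟩ : ∃ e, e = (1 + ε) / 2 := ⟨_, rfl⟩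
  have he0 : 0 ≤ e := by linarith
  have he1 : e < 1 := by linarith
  have h1e : 0 < 1 - e := by linarith
  obtain ⟨A, hA⟩ : ∃ A, A = |φ 0| * √Cw / (1 - e) := ⟨_, rfl⟩
  obtain ⟨Z, hZ⟩ : ∃ Z, Z = |B| + A := ⟨_, rfl⟩
  -- This is the only part of the trace bound that survives as `ρ` and `1 / √n` tend to 0, so `τ` is
  -- fixed first and `θ` is its modulus of continuity.
  obtain ⟨τ, hτ0, hτδ⟩ : ∃ τ : ℝ, 0 < τ ∧ 2 * Z ^ 2 * (τ / Cφ) / (1 - e) < δ := by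
    have hlim : Tendsto (fun τ : ℝ => 2 * Z ^ 2 * (τ / Cφ) / (1 - e)) (𝓝[>] 0) (𝓝 0) := by
      have : Continuous fun τ : ℝ => 2 * Z ^ 2 * (τ / Cφ) / (1 - e) := by fun_prop
      simpa using (this.tendsto 0).mono_left nhdsWithin_le_nhds
    obtain ⟨τ, h1, h2⟩ := ((hlim.eventually_lt_const hδ).and self_mem_nhdsWithin).exists
    exact ⟨τ, h2, h1⟩
  obtain ⟨θ, hθ0, hθ⟩ : ∃ θ > 0, ∀ a b, |a| ≤ Z / Cφ → |b| ≤ Z / Cφ → |a - b| < θ →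
      |deriv φ a - deriv φ b| ≤ τ := by
    have huc := (isCompact_Icc (a := -(Z / Cφ)) (b := Z / Cφ)).uniformContinuousOn_of_continuous
      hφ'.continuousOn
    obtain ⟨θ, hθ0, hθ⟩ := Metric.uniformContinuousOn_iff.1 huc τ hτ0
    exact ⟨θ, hθ0, fun a b ha hb hab => (hθ a (abs_le.1 ha) b (abs_le.1 hb) hab).le⟩
  rw [ENNReal.tendsto_nhds_zero]
  intro η hη
  obtain ⟨η', hη'0, hη'⟩ := ENNReal.lt_iff_exists_nnreal_btwn.1 hη
  obtain ⟨M, hM⟩ := hd η' (by exact_mod_cast hη'0)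
  set ρ : ℕ → ℝ := fun i =>
    Cφ * (√|CD| + A) / (1 - e) * max M 0 / √(K i + 1 : ℝ) with hρdef
  have hρ : Tendsto ρ atTop (𝓝 0) := by
    refine Tendsto.const_div_atTop (Real.tendsto_sqrt_atTop.comp ?_) _
    exact tendsto_atTop_add_const_right _ _ (tendsto_natCast_atTop_atTop.comp hK)
  have hs : Tendsto (fun i => (√(n i : ℝ))⁻¹) atTop (𝓝 0) :=
    (Real.tendsto_sqrt_atTop.comp (tendsto_natCast_atTop_atTop.comp hn)).inv_tendsto_atTop
  have ev1 : ∀ᶠ i in atTop, Cφ * ρ i < e - ε := by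
    have : Tendsto (fun i => Cφ * ρ i) atTop (𝓝 0) := by simpa using hρ.const_mul Cφ
    exact this.eventually_lt_const (by linarith)
  have ev2 : ∀ᶠ i in atTop, ρ i * Z / (1 - e) < θ := by
    have : Tendsto (fun i => ρ i * Z / (1 - e)) atTop (𝓝 0) := by
      simpa using (hρ.mul_const Z).div_const (1 - e)
    exact this.eventually_lt_const hθ0
  have ev3 : ∀ᶠ i in atTop, 2 * (Z ^ 2 / ((1 - e) ^ 2 * √(n i : ℝ))) < δ := by
    have : Tendsto (fun i => 2 * (Z ^ 2 / ((1 - e) ^ 2 * √(n i : ℝ)))) atTop (𝓝 0) := by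
      have h1 := (hs.const_mul (Z ^ 2 / (1 - e) ^ 2)).const_mul 2
      simp only [mul_zero] at h1
      refine h1.congr fun i => ?_
      rw [← div_eq_mul_inv, div_div]
    exact this.eventually_lt_const hδ
  have ev4 : ∀ᶠ i in atTop,
      2 * Z ^ 2 * (τ / Cφ + Cφ * ρ i + 2 / ((1 - e) * √(n i : ℝ))) / (1 - e) +
        2 * Z * (Cφ * (ρ i * Z) / (1 - e)) / (1 - e) ^ 2 < δ := by
    have hcont : Continuous fun q : ℝ × ℝ =>
        2 * Z ^ 2 * (τ / Cφ + Cφ * q.1 + 2 / (1 - e) * q.2) / (1 - e) +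
          2 * Z * (Cφ * (q.1 * Z) / (1 - e)) / (1 - e) ^ 2 := by fun_prop
    have hlim := (hcont.tendsto (0, 0)).comp (hρ.prodMk_nhds hs)
    simp only [mul_zero, add_zero, zero_mul, zero_div] at hlim
    refine (hlim.eventually_lt_const hτδ).mono fun i hi => ?_
    rwa [← div_div, div_eq_mul_inv (2 / (1 - e))]
  filter_upwards [hM, ev1, ev2, ev3, ev4] with i hMi h1 h2 h3 h4
  refine le_trans ?_ (hMi.trans ((ENNReal.ofReal_coe_nnreal).le.trans hη'.le))
  -- Almost surely the bad event lies in the event that the total direction exceeds `M`; comparing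
  -- outer measures avoids measurability of the supremum.
  refine measure_mono_ae ?_
  filter_upwards [hSP i, hflow i] with ω hSPω hflowω
  rintro ⟨t, ht, x, x', hx, hx', hbad⟩
  by_contra hnot
  have htotal : DepthNTK.totalDirection (D i) T (d i ω) ≤ ENNReal.ofReal (max M 0) :=
    (not_lt.1 hnot).trans (ENNReal.ofReal_le_ofReal (le_max_left _ _))
  have := hD i
  have hBx : B * √(n i : ℝ) ≤ |B| * √(n i : ℝ) := by
    gcongr
    exact le_abs_self B
  have hCDi : ∫⁻ x, ‖x‖ₑ ^ 2 ∂(D i) ≤ ENNReal.ofReal (|CD| * n i) :=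
    (hD2 i).trans (ENNReal.ofReal_le_ofReal (by gcongr; exact le_abs_self CD))
  obtain ⟨hF, hTr⟩ := hflowω.ntk_sub_le hφ hC hφ' he0 he1 hh (hnpos i) (hw i) (hw0 i)
    (abs_nonneg B) (abs_nonneg CD) (hw1 i) hCDi hT (le_max_right M 0) hSPω htotal hA hZ rfl h1
    hτ0.le (fun a b ha hb hab => hθ a b ha hb (hab.trans_lt h2)) ht (hx.trans hBx) (hx'.trans hBx)
  rcases hbad with hbad | hbad
  · exact absurd (hbad.trans hF) (not_le.2 h3)
  · exact absurd (hbad.trans hTr) (not_le.2 h4)
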